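/- **Constraint modules.** A constraint $\mathbb{R}$-module is $E=(E_T,E_N,E_0)$ with $\mathbb{R}$-vector spaces $E_T,E_N$, a linear map $\iota\colon E_N\to E_T$ (not necessarily injective) and a subspace $E_0\subseteq E_N$. A morphism $f\colon E\to F$ is a pair of linear maps $f_T\colon E_T\to F_T$, $f_N\colon E_N\to F_N$ with $\iota_F f_N=f_T\iota_E$ and $f_N(E_0)\subseteq F_0$; an isomorphism is an invertible morphism. **The constraint manifold $\mathbb{R}^n$.** Let $0\le n_0\le n_N\le n_T$ be integers and $\mathbb{R}^n=(\mathbb{R}^{n_T},\mathbb{R}^{n_N},\mathbb{R}^{n_0})$: the manifold $\mathbb{R}^{n_T}$ with coordinates $x^1,\dots,x^{n_T}$, the submanifold $C=\mathbb{R}^{n_N}\times\{0\}$, and the distribution $D=\langle\partial_1,\dots,\partial_{n_0}\rangle\subseteq TC$. Put $A_T=C^\infty(\mathbb{R}^{n_T})$, $A_N=\{f\in A_T : (\partial_jf)|_C=0 \text{ for } j\le n_0\}$, $A_0=\{f\in A_T : f|_C=0\}\subseteq A_N$; this is $C^\infty(\mathbb{R}^n)$. **Hochschild cohomology.** Let $C^k_{\mathrm{diff}}(C^\infty(\mathbb{R}^n))$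 be the constraint module whose $T$-component consists of the $k$-differential operators on $A_T$ (finite sums $\sum c^{I_1,\dots,I_k}\,\partial_{I_1}f_1\cdots\partial_{I_k}f_k$ with $c^{I_1,\dots,I_k}\in A_T$), whose $N$-component consists of those $\phi$ with $\phi(A_N,\dots,A_N)\subseteq A_N$ and with $\phi(f_1,\dots,f_k)\in A_0$ whenever all $f_i\in A_N$ and at least one $f_i\in A_0$, and whose $0$-component consists of those $\phi$ in the $N$-component with $\phi(A_N,\dots,A_N)\subseteq A_0$; $\iota$ is the inclusion. With the Hochschild differential $$(\delta D)(f,g)=fD(g)-D(fg)+D(f)g,$$ $$(\delta B)(f,g,h)=fB(g,h)-B(fg,h)+B(f,gh)-B(f,g)h$$ let $HH^2_{\mathrm{diff}}(C^\infty(\mathbb{R}^n))$ be the constraint module with $T$- and $N$-components $\ker(\delta|_{C^2})/\delta(C^1)$ formed in the $T$- and in the $N$-components of the complex respectively, with $0$-component the classes in the $N$-component represented by cocycles in $C^2_{\mathrm{diff}}(C^\infty(\mathbb{R}^n))_0$, and with $\iota$ induced by the inclusion. **Extended constraint bivector fields.** Let $\Gamma_T$ be the vector fields on $\mathbb{R}^{n_T}$,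 $\Gamma_0=\{X\in\Gamma_T : X|_C\in\Gamma^\infty(D)\}$, and $\Gamma_N$ the set of $X\in\Gamma_T$ that are tangent to $C$ along $C$ and satisfy $[\partial_j,X]|_C\in\Gamma^\infty(D)$ for $j\le n_0$. Let $\mathfrak{X}^2_T$ be the space of all bivector fields on $\mathbb{R}^{n_T}$, $\mathfrak{X}^2_0$ the span of all $X\wedge Y$ with $X\in\Gamma_0$, $Y\in\Gamma_T$, and $\mathfrak{X}^2_N=\mathfrak{X}^2_0+\mathrm{span}\{X\wedge Y : X,Y\in\Gamma_N\}$. Let $$S=\bigoplus_{k\ge1}\mathrm{Sym}^k\,\Gamma^\infty\big(T\mathbb{R}^{n_0}|_{\mathbb{R}^{n_N}}\big)\vee\Gamma^\infty\big(T\mathbb{R}^{n_T-n_N}|_{\mathbb{R}^{n_N}}\big),$$ the symmetric products being over $C^\infty(\mathbb{R}^{n_N})$, where $T\mathbb{R}^{n_0}$ is spanned by $\partial_1,\dots,\partial_{n_0}$ and $T\mathbb{R}^{n_T-n_N}$ by $\partial_{n_N+1},\dots,\partial_{n_T}$. The constraint module $\mathfrak{X}^2_{\mathrm{ext}}(\mathbb{R}^n)$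 has components $\mathfrak{X}^2_T$, $\mathfrak{X}^2_N\oplus S$, $\mathfrak{X}^2_0\oplus S$ and $\iota(X,P)=X$. **The map.** For a bivector field $X=\tfrac12\sum X^{ij}\partial_i\wedge\partial_j$ with antisymmetric components put $\mathcal{U}(X)(f,g)=\tfrac12X(\mathrm{d}f,\mathrm{d}g)=\tfrac12\sum_{i,j}X^{ij}\,\partial_if\,\partial_jg$. For $P\in S$ let $\mathrm{prol}(P)$ be the symmetric multivector field on $\mathbb{R}^{n_T}$ obtained by extending all coefficient functions constantly in $x^{n_N+1},\dots,x^{n_T}$, and let $\mathrm{Op}$ send $c\,\partial_{i_1}\vee\dots\vee\partial_{i_r}$ to the differential operator $c\,\frac{\partial^r}{\partial x^{i_1}\cdots\partial x^{i_r}}$. **Theorem (second constraint Hochschild cohomology on $\mathbb{R}^n$).** The maps $$(\mathcal{U}_{\mathrm{ext}})_T(X)=[\mathcal{U}(X)],\qquad(\mathcal{U}_{\mathrm{ext}})_N(X,P)=[\mathcal{U}(X)+\delta(\mathrm{Op}(\mathrm{prol}(P)))]$$ define a morphism $\mathcal{U}_{\mathrm{ext}}\colon\mathfrak{X}^2_{\mathrm{ext}}(\mathbb{R}^n)\to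 HH^2_{\mathrm{diff}}(C^\infty(\mathbb{R}^n))$ of constraint $\mathbb{R}$-modules, and this morphism is an isomorphism of constraint $\mathbb{R}$-modules. -/

import Mathlib

open scoped ContDiff

noncomputable section

/-! ### Constraint modules -/

/-- A constraint `R`-module `E = (E_T, E_N, E_0)`: a module homomorphism `ι : E_N → E_T`
(not necessarily injective) together with a submodule `E_0 ⊆ E_N` (written `Z` below). -/
structure ConModule (R : Type) [CommRing R] where
  T : Type
  N : Type
  [addCommGroupT : AddCommGroup T]
  [addCommGroupN : AddCommGroup N]
  [moduleT : Module R T]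
  [moduleN : Module R N]
  ι : N →ₗ[R] T
  Z : Submodule R N

namespace ConModule

attribute [instance] addCommGroupT addCommGroupN moduleT moduleN

variable {R : Type} [CommRing R]

/-- A morphism of constraint modules: a pair `(f_T, f_N)` of linear maps compatible with `ι`
such that `f_N` preserves the `0`-components. -/
structure Hom (E F : ConModule R) where
  T : E.T →ₗ[R] F.T
  N : E.N →ₗ[R] F.N
  comm : ∀ x, F.ι (N x) = T (E.ι x)
  map_Z : ∀ x ∈ E.Z, N x ∈ F.Z

/-- The identity morphism. -/
def Hom.id (E : ConModule R) : Hom E E where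
  T := LinearMap.id
  N := LinearMap.id
  comm _ := rfl
  map_Z _ h := h

/-- Composition of morphisms, `g ∘ f`. -/
def Hom.comp {E F G : ConModule R} (g : Hom F G) (f : Hom E F) : Hom E G where
  T := g.T ∘ₗ f.T
  N := g.N ∘ₗ f.N
  comm x := by simp [g.comm, f.comm]
  map_Z x h := g.map_Z _ (f.map_Z x h)

/-- Isomorphisms of constraint modules are the invertible morphisms. -/
def Hom.IsIso {E F : ConModule R} (f : Hom E F) : Prop :=
  ∃ g : Hom F E, g.comp f = Hom.id E ∧ f.comp g = Hom.id F

/-- The embedded constraint module given by submodules `Z ≤ N ≤ T` of a module `V`. -/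
def ofSubmodules {V : Type} [AddCommGroup V] [Module R V] (T N Z : Submodule R V)
    (hNT : N ≤ T) : ConModule R where
  T := T
  N := N
  ι := Submodule.inclusion hNT
  Z := Z.comap N.subtype

/-- The cohomology `ker g / im f` of constraint modules `E --f--> F --g--> G` with `g ∘ f = 0`:
`T`- and `N`-components are the cohomologies of the components, and the `0`-component consists
of the classes of those elements of `ker g_N` that lie in `F_0`. -/
def cohomology {E F G : ConModule R} (f : Hom E F) (g : Hom F G)
    (hT : ∀ x, g.T (f.T x) = 0) (hN : ∀ x, g.N (f.N x) = 0) : ConModule R where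
  T := LinearMap.ker g.T ⧸ LinearMap.range (f.T.codRestrict (LinearMap.ker g.T) hT)
  N := LinearMap.ker g.N ⧸ LinearMap.range (f.N.codRestrict (LinearMap.ker g.N) hN)
  ι := Submodule.mapQ _ _
    (F.ι.restrict (p := LinearMap.ker g.N) (q := LinearMap.ker g.T) (fun x hx => by
      rw [LinearMap.mem_ker] at hx ⊢
      rw [← g.comm, hx, map_zero]))
    (by
      rintro _ ⟨y, rfl⟩
      refine ⟨E.ι y, Subtype.ext ?_⟩
      exact (f.comm y).symm)
  Z := (F.Z.comap (LinearMap.ker g.N).subtype).map (Submodule.mkQ _)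

end ConModule

/-! ### Smooth functions on `ℝ^m` and their partial derivatives -/

/-- The smooth real-valued functions on `ℝ^m` as a subalgebra of all functions. -/
def smoothSubalgebra (m : ℕ) : Subalgebra ℝ ((Fin m → ℝ) → ℝ) where
  carrier := {f | ContDiff ℝ ∞ f}
  mul_mem' {f g} (hf : ContDiff ℝ ∞ f) (hg : ContDiff ℝ ∞ g) := hf.mul hg
  add_mem' {f g} (hf : ContDiff ℝ ∞ f) (hg : ContDiff ℝ ∞ g) := hf.add hg
  algebraMap_mem' c := show ContDiff ℝ ∞ (fun _ : Fin m → ℝ => c) from contDiff_const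

/-- The algebra `C^∞(ℝ^m)` of smooth real-valued functions. -/
def Smooth (m : ℕ) : Type := smoothSubalgebra m

namespace Smooth

variable {m : ℕ}

instance : CommRing (Smooth m) := inferInstanceAs (CommRing (smoothSubalgebra m))

instance : Algebra ℝ (Smooth m) := inferInstanceAs (Algebra ℝ (smoothSubalgebra m))

instance : CoeFun (Smooth m) fun _ => (Fin m → ℝ) → ℝ := ⟨fun f => f.1⟩

theorem contDiff (f : Smooth m) : ContDiff ℝ ∞ f := f.2

theorem differentiableAt (f : Smooth m) (x : Fin m → ℝ) : DifferentiableAt ℝ f x :=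
  (f.contDiff.differentiable (by simp)) x

theorem ext {f g : Smooth m} (h : ∀ x, f x = g x) : f = g := Subtype.ext (funext h)

theorem add_apply (f g : Smooth m) (x : Fin m → ℝ) : (f + g) x = f x + g x := rfl

theorem mul_apply (f g : Smooth m) (x : Fin m → ℝ) : (f * g) x = f x * g x := rfl

theorem smul_apply (c : ℝ) (f : Smooth m) (x : Fin m → ℝ) : (c • f) x = c * f x := rfl

end Smooth

/-- The partial derivative `∂/∂x^i` on `C^∞(ℝ^m)`. -/
def pd {m : ℕ} (i : Fin m) : Smooth m →ₗ[ℝ] Smooth m where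
  toFun f := ⟨fun x => fderiv ℝ f x (Pi.single i 1),
    (f.contDiff.fderiv_right (m := ∞) (by simp)).clm_apply contDiff_const⟩
  map_add' f g := Smooth.ext fun x =>
    congrArg (fun L => L (Pi.single i 1)) (fderiv_add (f.differentiableAt x) (g.differentiableAt x))
  map_smul' c f := Smooth.ext fun x =>
    congrArg (fun L => L (Pi.single i 1)) (fderiv_const_smul (f.differentiableAt x) c)

theorem pd_apply {m : ℕ} (i : Fin m) (f : Smooth m) (x : Fin m → ℝ) :
    pd i f x = fderiv ℝ f x (Pi.single i 1) := rfl

theorem pd_mul {m : ℕ} (i : Fin m) (f g : Smooth m) :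
    pd i (f * g) = f * pd i g + pd i f * g := by
  refine Smooth.ext fun x => ?_
  have := congrArg (fun L => L (Pi.single i 1))
    (fderiv_mul (f.differentiableAt x) (g.differentiableAt x))
  refine this.trans ?_
  simp [Smooth.add_apply, Smooth.mul_apply, pd_apply, mul_comm]

theorem pd_comm {m : ℕ} (i j : Fin m) (f : Smooth m) : pd i (pd j f) = pd j (pd i f) := by
  refine Smooth.ext fun x => ?_
  have hd : DifferentiableAt ℝ (fderiv ℝ f) x :=
    ((f.contDiff.fderiv_right (m := ∞) (by simp)).differentiable (by simp)) x
  have hs : IsSymmSndFDerivAt ℝ f x :=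
    f.contDiff.contDiffAt.isSymmSndFDerivAt (by
      simpa using (WithTop.coe_le_coe.2 le_top : ((2 : ℕ∞) : WithTop ℕ∞) ≤ ∞))
  have key : ∀ a b : Fin m,
      pd a (pd b f) x = fderiv ℝ (fderiv ℝ f) x (Pi.single a 1) (Pi.single b 1) := by
    intro a b
    have := congrArg (fun L => L (Pi.single a 1))
      (fderiv_clm_apply hd (differentiableAt_const (Pi.single b (1 : ℝ))))
    refine this.trans ?_
    simp
  rw [key, key]
  exact hs _ _

/-- For a tuple `I = (i₁, …, i_r)` the operator `∂_I = ∂^r / ∂x^{i₁} ⋯ ∂x^{i_r}`. -/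
def pdList {m : ℕ} (I : List (Fin m)) : Smooth m →ₗ[ℝ] Smooth m :=
  (I.map fun i => (pd i : Module.End ℝ (Smooth m))).prod

/-- For an exponent vector `k = (k_1, …, k_m)` the operator
`∂^k = (∂/∂x^1)^{k_1} ⋯ (∂/∂x^m)^{k_m}`. -/
def pdPow {m : ℕ} (k : Fin m →₀ ℕ) : Smooth m →ₗ[ℝ] Smooth m :=
  (List.ofFn fun i => (pd i : Module.End ℝ (Smooth m)) ^ k i).prod

/-- The symbol calculus of the flat covariant derivative: a symmetric multivector field, i.e. a
polynomial in the commuting symbols `∂_1, …, ∂_m` with coefficients in `C^∞(ℝ^m)`, is sent to the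
differential operator with the same coefficients, `c ∂_{i₁} ∨ ⋯ ∨ ∂_{i_r} ↦ c ∂^r/∂x^{i₁}⋯∂x^{i_r}`. -/
def opSymbol (m : ℕ) :
    MvPolynomial (Fin m) (Smooth m) →ₗ[Smooth m] (Smooth m →ₗ[ℝ] Smooth m) :=
  (MvPolynomial.basisMonomials (Fin m) (Smooth m)).constr (Smooth m) pdPow

/-! ### The constraint manifold `ℝ^n` and its constraint functions -/

/-- A constraint dimension `n = (n_T, n_N, n_0)` with `n_0 ≤ n_N ≤ n_T`. It stands for the constraint
manifold `ℝ^n` with ambient manifold `ℝ^{n_T}`, submanifold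
`C = ℝ^{n_N} × {0}` and distribution `D ⊆ TC` spanned by the first `n_0` coordinate
directions. -/
structure ConDim where
  T : ℕ
  N : ℕ
  Z : ℕ
  hZN : Z ≤ N
  hNT : N ≤ T

namespace ConDim

variable (n : ConDim)

/-- The algebra `C^∞(ℝ^{n_T})`. -/
abbrev A : Type := Smooth n.T

/-- The submanifold `C = ℝ^{n_N} × {0} ⊆ ℝ^{n_T}`. -/
def sub : Set (Fin n.T → ℝ) := {x | ∀ i : Fin n.T, n.N ≤ i → x i = 0}

/-- `C^∞(ℝ^n)_0`: the vanishing ideal of `C`. -/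
def fnZ : Ideal n.A where
  carrier := {f | ∀ x ∈ n.sub, f x = 0}
  add_mem' {f g} hf hg x hx := by rw [Smooth.add_apply, hf x hx, hg x hx, add_zero]
  zero_mem' x _ := rfl
  smul_mem' c f hf x hx := by rw [smul_eq_mul, Smooth.mul_apply, hf x hx, mul_zero]

/-- `C^∞(ℝ^n)_N`: the functions whose restriction to `C` is constant along the distribution `D`,
i.e. has vanishing derivative along `D`. -/
def fnN : Subalgebra ℝ n.A where
  carrier := {f | ∀ i : Fin n.T, i < n.Z → pd i f ∈ n.fnZ}
  add_mem' {f g} hf hg i hi := by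
    rw [map_add]
    exact add_mem (hf i hi) (hg i hi)
  mul_mem' {f g} hf hg i hi := by
    rw [pd_mul]
    exact add_mem (Ideal.mul_mem_left _ _ (hg i hi)) (Ideal.mul_mem_right _ _ (hf i hi))
  algebraMap_mem' c i _ := by
    have : pd i (algebraMap ℝ n.A c) = 0 := by
      refine Smooth.ext fun x => ?_
      exact congrArg (fun L => L (Pi.single i 1)) (fderiv_const_apply (𝕜 := ℝ) (x := x) c)
    rw [this]
    exact zero_mem _

/-! ### Constraint vector fields and bivector fields -/

/-- Vector fields `X = ∑ X^i ∂_i` on `ℝ^{n_T}`, given by their components. -/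
abbrev Vec : Type := Fin n.T → n.A

/-- `Γ^∞(Tℝ^n)_0`: the vector fields whose restriction to `C` takes values in `D`. -/
def vecZ : Submodule ℝ n.Vec where
  carrier := {X | ∀ i : Fin n.T, n.Z ≤ i → X i ∈ n.fnZ}
  add_mem' hX hY i hi := add_mem (hX i hi) (hY i hi)
  zero_mem' _ _ := zero_mem _
  smul_mem' c _ hX i hi := (n.fnZ.restrictScalars ℝ).smul_mem c (hX i hi)

/-- `Γ^∞(Tℝ^n)_N`: the vector fields `X` that are tangent to `C` on `C` and whose class modulo
`D` on `C` is parallel along `D` for the Bott connection, i.e. `[∂_j, X]` takes values in `D` on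
`C` for each of the directions `∂_j` spanning `D`. -/
def vecN : Submodule ℝ n.Vec where
  carrier := {X | (∀ i : Fin n.T, n.N ≤ i → X i ∈ n.fnZ) ∧
    ∀ j : Fin n.T, j < n.Z → (fun i => pd j (X i)) ∈ n.vecZ}
  add_mem' {X Y} hX hY := ⟨fun i hi => add_mem (hX.1 i hi) (hY.1 i hi), fun j hj => by
    simpa [Pi.add_def] using add_mem (hX.2 j hj) (hY.2 j hj)⟩
  zero_mem' := ⟨fun _ _ => zero_mem _, fun j _ => by
    simpa [Pi.zero_def] using zero_mem n.vecZ⟩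
  smul_mem' c X hX := ⟨fun i hi => (n.fnZ.restrictScalars ℝ).smul_mem c (hX.1 i hi),
    fun j hj => by simpa [Pi.smul_def] using n.vecZ.smul_mem c (hX.2 j hj)⟩

/-- Bivector fields `π = ½ ∑ π^{ij} ∂_i ∧ ∂_j` on `ℝ^{n_T}`, given by their antisymmetric matrix of
smooth components `π^{ij} = π(dx^i, dx^j)`. -/
def biv : Submodule ℝ (Fin n.T → Fin n.T → n.A) where
  carrier := {π | ∀ i j, π i j = - π j i}
  add_mem' {π ρ} hπ hρ i j := by
    change π i j + ρ i j = - (π j i + ρ j i)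
    rw [hπ i j, hρ i j]; ring
  zero_mem' i j := by simp
  smul_mem' c π hπ i j := by
    change c • π i j = - (c • π j i)
    rw [hπ i j, smul_neg]

/-- The wedge product `X ∧ Y` of vector fields. -/
def wedge (X Y : n.Vec) : Fin n.T → Fin n.T → n.A := fun i j => X i * Y j - X j * Y i

/-- The `0`-component of the strong second exterior power of the constraint vector fields: sums of
`X ∧ Y` with `X ∈ Γ^∞(Tℝ^n)_0` and `Y` an arbitrary vector field. -/
def bivZ : Submodule ℝ (Fin n.T → Fin n.T → n.A) :=
  Submodule.span ℝ {π | ∃ X ∈ n.vecZ, ∃ Y : n.Vec, π = n.wedge X Y}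

/-- The `N`-component of the strong second exterior power of the constraint vector fields: sums of
`X ∧ Y` with both `X, Y ∈ Γ^∞(Tℝ^n)_N`, or with `X ∈ Γ^∞(Tℝ^n)_0` and `Y` arbitrary. -/
def bivN : Submodule ℝ (Fin n.T → Fin n.T → n.A) :=
  Submodule.span ℝ {π | ∃ X ∈ n.vecN, ∃ Y ∈ n.vecN, π = n.wedge X Y} ⊔ n.bivZ

theorem wedge_mem (X Y : n.Vec) : n.wedge X Y ∈ n.biv := fun i j => by
  simp only [wedge]; ring

theorem bivN_le : n.bivN ≤ n.biv := by
  refine sup_le (Submodule.span_le.2 ?_) (Submodule.span_le.2 ?_)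
  · rintro _ ⟨X, -, Y, -, rfl⟩
    exact n.wedge_mem X Y
  · rintro _ ⟨X, -, Y, rfl⟩
    exact n.wedge_mem X Y

/-! ### Extended constraint bivector fields -/

/-- The algebra `C^∞(ℝ^{n_N})` of smooth functions on the submanifold. -/
abbrev B : Type := Smooth n.N

/-- The symmetric algebra over `C^∞(ℝ^{n_N})` of the free module
`Γ^∞(Tℝ^{n_T}|_{ℝ^{n_N}})` with basis `∂_1, …, ∂_{n_T}`: polynomials in these symbols. -/
abbrev SymC : Type := MvPolynomial (Fin n.T) n.B

/-- `Γ^∞(Tℝ^{n_0}|_{ℝ^{n_N}})`, in degree one of the symmetric algebra. -/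
def symDist : Submodule n.B n.SymC :=
  Submodule.span n.B {P | ∃ i : Fin n.T, i < n.Z ∧ P = MvPolynomial.X i}

/-- `Γ^∞(Tℝ^{n_T - n_N}|_{ℝ^{n_N}})`, in degree one of the symmetric algebra. -/
def symNormal : Submodule n.B n.SymC :=
  Submodule.span n.B {P | ∃ i : Fin n.T, n.N ≤ i ∧ P = MvPolynomial.X i}

/-- `⨁_{k ≥ 1} Sym^k Γ^∞(Tℝ^{n_0}|_{ℝ^{n_N}}) ∨ Γ^∞(Tℝ^{n_T - n_N}|_{ℝ^{n_N}})`; the sum is direct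
because the `k`-th summand is homogeneous of degree `k + 1`. -/
def extSym : Submodule n.B n.SymC := ⨆ k : ℕ, n.symDist ^ (k + 1) * n.symNormal

/-- The constraint module `𝔛²_ext(ℝ^n)` of extended constraint bivector fields. -/
def bivExt : ConModule ℝ where
  T := n.biv
  N := n.bivN × n.extSym
  ι := Submodule.inclusion n.bivN_le ∘ₗ LinearMap.fst ℝ _ _
  Z := (n.bivZ.comap n.bivN.subtype).prod ⊤

/-- The prolongation `C^∞(ℝ^{n_N}) → C^∞(ℝ^{n_T})`: extension of functions which is constant in
the last `n_T - n_N` coordinates. -/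
def prolFn : n.B →ₐ[ℝ] n.A where
  toFun f := ⟨fun x => f fun i => x (Fin.castLE n.hNT i),
    f.contDiff.comp (contDiff_pi.2 fun i => contDiff_apply ℝ ℝ (Fin.castLE n.hNT i))⟩
  map_one' := rfl
  map_mul' _ _ := rfl
  map_zero' := rfl
  map_add' _ _ := rfl
  commutes' _ := rfl

/-- The prolongation of symmetric multivector fields along `C`, coefficient by coefficient. -/
def prol : n.SymC →ₗ[ℝ] MvPolynomial (Fin n.T) n.A :=
  (MvPolynomial.mapAlgHom (σ := Fin n.T) n.prolFn).toLinearMap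

/-! ### The differential constraint Hochschild complex in degrees one to three

Since `C^∞(ℝ^n)` is embedded, a constraint cochain `(φ_T, φ_N)` is determined by `φ_T`, and
the constraint cochains are the multilinear maps `φ` on `C^∞(ℝ^{n_T})` that restrict suitably. -/

/-- Hochschild one-cochains of `C^∞(ℝ^{n_T})`. -/
abbrev C1 : Type := n.A →ₗ[ℝ] n.A

/-- Hochschild two-cochains of `C^∞(ℝ^{n_T})`. -/
abbrev C2 : Type := n.A →ₗ[ℝ] n.A →ₗ[ℝ] n.A

/-- Hochschild three-cochains of `C^∞(ℝ^{n_T})`. -/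
abbrev C3 : Type := n.A →ₗ[ℝ] n.A →ₗ[ℝ] n.A →ₗ[ℝ] n.A

instance : AddCommGroup n.C2 := @LinearMap.addCommGroup ℝ ℝ n.A n.C1 _ _ _ _ _ _ _

instance : AddCommGroup n.C3 := @LinearMap.addCommGroup ℝ ℝ n.A n.C2 _ _ _ _ _ _ _

/-- The cup product `(f, g) ↦ D f · E g` of one-cochains. -/
def cup (D E : n.C1) : n.C2 := (LinearMap.mul ℝ n.A).compl₁₂ D E

/-- The cup product `(f, g, h) ↦ D f · E g · F h` of one-cochains. -/
def cup₃ (D E F : n.C1) : n.C3 :=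
  LinearMap.mk₂ ℝ (fun f g => LinearMap.mulLeft ℝ (D f * E g) ∘ₗ F)
    (fun _ _ _ => by refine LinearMap.ext fun h => ?_; simp [add_mul, mul_assoc])
    (fun _ _ _ => by refine LinearMap.ext fun h => ?_; simp [mul_assoc])
    (fun _ _ _ => by refine LinearMap.ext fun h => ?_; simp [mul_add, add_mul, mul_assoc])
    (fun _ _ _ => by refine LinearMap.ext fun h => ?_; simp [mul_assoc])

/-- Differential operators `∑ c^I ∂_I` on `ℝ^{n_T}` (finite sums, smooth coefficients). -/
def diff1 : Submodule n.A n.C1 := Submodule.span n.A {D | ∃ I, D = pdList I}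

/-- Bidifferential operators `∑ c^{I,J} ∂_I ∪ ∂_J` on `ℝ^{n_T}`. -/
def diff2 : Submodule n.A n.C2 :=
  Submodule.span n.A {D | ∃ I J, D = n.cup (pdList I) (pdList J)}

/-- Tridifferential operators `∑ c^{I,J,K} ∂_I ∪ ∂_J ∪ ∂_K` on `ℝ^{n_T}`. -/
def diff3 : Submodule n.A n.C3 :=
  Submodule.span n.A {D | ∃ I J K, D = n.cup₃ (pdList I) (pdList J) (pdList K)}

/-- `C^1_diff(C^∞(ℝ^n))_N`. -/
def diff1N : Submodule ℝ n.C1 where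
  carrier := {D | D ∈ n.diff1 ∧ (∀ f ∈ n.fnN, D f ∈ n.fnN) ∧ ∀ f ∈ n.fnZ, D f ∈ n.fnZ}
  add_mem' hD hE := ⟨add_mem hD.1 hE.1, fun f hf => add_mem (hD.2.1 f hf) (hE.2.1 f hf),
    fun f hf => add_mem (hD.2.2 f hf) (hE.2.2 f hf)⟩
  zero_mem' := ⟨zero_mem _, fun _ _ => zero_mem _, fun _ _ => zero_mem _⟩
  smul_mem' c _ hD := ⟨(n.diff1.restrictScalars ℝ).smul_mem c hD.1,
    fun f hf => n.fnN.smul_mem (hD.2.1 f hf) c,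
    fun f hf => (n.fnZ.restrictScalars ℝ).smul_mem c (hD.2.2 f hf)⟩

/-- `C^1_diff(C^∞(ℝ^n))_0`. -/
def diff1Z : Submodule ℝ n.C1 where
  carrier := {D | D ∈ n.diff1N ∧ ∀ f ∈ n.fnN, D f ∈ n.fnZ}
  add_mem' hD hE := ⟨add_mem hD.1 hE.1, fun f hf => add_mem (hD.2 f hf) (hE.2 f hf)⟩
  zero_mem' := ⟨zero_mem _, fun _ _ => zero_mem _⟩
  smul_mem' c _ hD := ⟨n.diff1N.smul_mem c hD.1,
    fun f hf => (n.fnZ.restrictScalars ℝ).smul_mem c (hD.2 f hf)⟩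

/-- `C^2_diff(C^∞(ℝ^n))_N`: bidifferential operators which map `N ⊗ N` to `N` and
`0 ⊗ N + N ⊗ 0` to `0`. -/
def diff2N : Submodule ℝ n.C2 where
  carrier := {D | D ∈ n.diff2 ∧ (∀ f ∈ n.fnN, ∀ g ∈ n.fnN, D f g ∈ n.fnN) ∧
    (∀ f ∈ n.fnZ, ∀ g ∈ n.fnN, D f g ∈ n.fnZ) ∧ ∀ f ∈ n.fnN, ∀ g ∈ n.fnZ, D f g ∈ n.fnZ}
  add_mem' hD hE := ⟨add_mem hD.1 hE.1,
    fun f hf g hg => add_mem (hD.2.1 f hf g hg) (hE.2.1 f hf g hg),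
    fun f hf g hg => add_mem (hD.2.2.1 f hf g hg) (hE.2.2.1 f hf g hg),
    fun f hf g hg => add_mem (hD.2.2.2 f hf g hg) (hE.2.2.2 f hf g hg)⟩
  zero_mem' := ⟨zero_mem _, fun _ _ _ _ => zero_mem _, fun _ _ _ _ => zero_mem _,
    fun _ _ _ _ => zero_mem _⟩
  smul_mem' c _ hD := ⟨(n.diff2.restrictScalars ℝ).smul_mem c hD.1,
    fun f hf g hg => n.fnN.smul_mem (hD.2.1 f hf g hg) c,
    fun f hf g hg => (n.fnZ.restrictScalars ℝ).smul_mem c (hD.2.2.1 f hf g hg),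
    fun f hf g hg => (n.fnZ.restrictScalars ℝ).smul_mem c (hD.2.2.2 f hf g hg)⟩

/-- `C^2_diff(C^∞(ℝ^n))_0`. -/
def diff2Z : Submodule ℝ n.C2 where
  carrier := {D | D ∈ n.diff2N ∧ ∀ f ∈ n.fnN, ∀ g ∈ n.fnN, D f g ∈ n.fnZ}
  add_mem' hD hE := ⟨add_mem hD.1 hE.1,
    fun f hf g hg => add_mem (hD.2 f hf g hg) (hE.2 f hf g hg)⟩
  zero_mem' := ⟨zero_mem _, fun _ _ _ _ => zero_mem _⟩
  smul_mem' c _ hD := ⟨n.diff2N.smul_mem c hD.1,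
    fun f hf g hg => (n.fnZ.restrictScalars ℝ).smul_mem c (hD.2 f hf g hg)⟩

/-- `C^3_diff(C^∞(ℝ^n))_N`: tridifferential operators which map `N ⊗ N ⊗ N` to `N` and
`0 ⊗ N ⊗ N + N ⊗ 0 ⊗ N + N ⊗ N ⊗ 0` to `0`. -/
def diff3N : Submodule ℝ n.C3 where
  carrier := {D | D ∈ n.diff3 ∧
    (∀ f ∈ n.fnN, ∀ g ∈ n.fnN, ∀ h ∈ n.fnN, D f g h ∈ n.fnN) ∧
    (∀ f ∈ n.fnZ, ∀ g ∈ n.fnN, ∀ h ∈ n.fnN, D f g h ∈ n.fnZ) ∧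
    (∀ f ∈ n.fnN, ∀ g ∈ n.fnZ, ∀ h ∈ n.fnN, D f g h ∈ n.fnZ) ∧
    ∀ f ∈ n.fnN, ∀ g ∈ n.fnN, ∀ h ∈ n.fnZ, D f g h ∈ n.fnZ}
  add_mem' hD hE := ⟨add_mem hD.1 hE.1,
    fun f hf g hg h hh => add_mem (hD.2.1 f hf g hg h hh) (hE.2.1 f hf g hg h hh),
    fun f hf g hg h hh => add_mem (hD.2.2.1 f hf g hg h hh) (hE.2.2.1 f hf g hg h hh),
    fun f hf g hg h hh => add_mem (hD.2.2.2.1 f hf g hg h hh) (hE.2.2.2.1 f hf g hg h hh),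
    fun f hf g hg h hh => add_mem (hD.2.2.2.2 f hf g hg h hh) (hE.2.2.2.2 f hf g hg h hh)⟩
  zero_mem' := ⟨zero_mem _, fun _ _ _ _ _ _ => zero_mem _, fun _ _ _ _ _ _ => zero_mem _,
    fun _ _ _ _ _ _ => zero_mem _, fun _ _ _ _ _ _ => zero_mem _⟩
  smul_mem' c _ hD := ⟨(n.diff3.restrictScalars ℝ).smul_mem c hD.1,
    fun f hf g hg h hh => n.fnN.smul_mem (hD.2.1 f hf g hg h hh) c,
    fun f hf g hg h hh => (n.fnZ.restrictScalars ℝ).smul_mem c (hD.2.2.1 f hf g hg h hh),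
    fun f hf g hg h hh => (n.fnZ.restrictScalars ℝ).smul_mem c (hD.2.2.2.1 f hf g hg h hh),
    fun f hf g hg h hh => (n.fnZ.restrictScalars ℝ).smul_mem c (hD.2.2.2.2 f hf g hg h hh)⟩

/-- `C^3_diff(C^∞(ℝ^n))_0`. -/
def diff3Z : Submodule ℝ n.C3 where
  carrier := {D | D ∈ n.diff3N ∧ ∀ f ∈ n.fnN, ∀ g ∈ n.fnN, ∀ h ∈ n.fnN, D f g h ∈ n.fnZ}
  add_mem' hD hE := ⟨add_mem hD.1 hE.1,
    fun f hf g hg h hh => add_mem (hD.2 f hf g hg h hh) (hE.2 f hf g hg h hh)⟩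
  zero_mem' := ⟨zero_mem _, fun _ _ _ _ _ _ => zero_mem _⟩
  smul_mem' c _ hD := ⟨n.diff3N.smul_mem c hD.1,
    fun f hf g hg h hh => (n.fnZ.restrictScalars ℝ).smul_mem c (hD.2 f hf g hg h hh)⟩

/-- The constraint module `C^1_diff(C^∞(ℝ^n))`. -/
def cochain1 : ConModule ℝ :=
  ConModule.ofSubmodules (n.diff1.restrictScalars ℝ) n.diff1N n.diff1Z
    fun D (h : D ∈ n.diff1N) => h.1

/-- The constraint module `C^2_diff(C^∞(ℝ^n))`. -/
def cochain2 : ConModule ℝ :=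
  ConModule.ofSubmodules (n.diff2.restrictScalars ℝ) n.diff2N n.diff2Z
    fun D (h : D ∈ n.diff2N) => h.1

/-- The constraint module `C^3_diff(C^∞(ℝ^n))`. -/
def cochain3 : ConModule ℝ :=
  ConModule.ofSubmodules (n.diff3.restrictScalars ℝ) n.diff3N n.diff3Z
    fun D (h : D ∈ n.diff3N) => h.1

/-- The Hochschild differential `(δD)(f, g) = f D(g) - D(f g) + D(f) g`. -/
def δ₁ : n.C1 →ₗ[ℝ] n.C2 where
  toFun D := n.cup LinearMap.id D - (LinearMap.mul ℝ n.A).compr₂ D + n.cup D LinearMap.id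
  map_add' D E := by
    refine LinearMap.ext fun f => LinearMap.ext fun g => ?_
    simp only [cup, LinearMap.add_apply, LinearMap.sub_apply, LinearMap.compl₁₂_apply,
      LinearMap.compr₂_apply, LinearMap.mul_apply', LinearMap.id_apply]
    ring
  map_smul' c D := by
    refine LinearMap.ext fun f => LinearMap.ext fun g => ?_
    simp only [cup, LinearMap.add_apply, LinearMap.sub_apply, LinearMap.compl₁₂_apply,
      LinearMap.compr₂_apply, LinearMap.mul_apply', LinearMap.id_apply, LinearMap.smul_apply,
      RingHom.id_apply, smul_add, smul_sub, mul_smul_comm, smul_mul_assoc]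

theorem δ₁_apply (D : n.C1) (f g : n.A) : n.δ₁ D f g = f * D g - D (f * g) + D f * g := rfl

/-- The Hochschild differential
`(δD)(f, g, h) = f D(g, h) - D(f g, h) + D(f, g h) - D(f, g) h`. -/
def δ₂ : n.C2 →ₗ[ℝ] n.C3 where
  toFun D := LinearMap.mk₂ ℝ
    (fun f g => LinearMap.mulLeft ℝ f ∘ₗ D g - D (f * g) + D f ∘ₗ LinearMap.mulLeft ℝ g
      - LinearMap.mulLeft ℝ (D f g))
    (fun f f' g => by
      refine LinearMap.ext fun h => ?_
      simp [add_mul]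
      ring)
    (fun c f g => by
      refine LinearMap.ext fun h => ?_
      simp [smul_add, smul_sub])
    (fun f g g' => by
      refine LinearMap.ext fun h => ?_
      simp [add_mul, mul_add]
      ring)
    (fun c f g => by
      refine LinearMap.ext fun h => ?_
      simp [smul_add, smul_sub])
  map_add' D E := by
    refine LinearMap.ext fun f => LinearMap.ext fun g => LinearMap.ext fun h => ?_
    simp [add_mul, mul_add]
    ring
  map_smul' c D := by
    refine LinearMap.ext fun f => LinearMap.ext fun g => LinearMap.ext fun h => ?_
    simp [smul_add, smul_sub]

theorem δ₂_apply (D : n.C2) (f g h : n.A) :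
    n.δ₂ D f g h = f * D g h - D (f * g) h + D f (g * h) - D f g * h := rfl

/-! ### The complex -/

theorem pdList_nil {m : ℕ} : pdList (m := m) [] = LinearMap.id := rfl

theorem pdList_cons {m : ℕ} (i : Fin m) (I : List (Fin m)) :
    pdList (i :: I) = pd i ∘ₗ pdList I := by
  simp [pdList, Module.End.mul_eq_comp]

theorem pdList_single {m : ℕ} (i : Fin m) : pdList [i] = pd i := by
  rw [pdList_cons, pdList_nil, LinearMap.comp_id]

theorem cup_apply (D E : n.C1) (f g : n.A) : n.cup D E f g = D f * E g := rfl

theorem cup₃_apply (D E F : n.C1) (f g h : n.A) : n.cup₃ D E F f g h = D f * E g * F h := rfl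

theorem cup_mem (I J : List (Fin n.T)) : n.cup (pdList I) (pdList J) ∈ n.diff2 :=
  Submodule.subset_span ⟨I, J, rfl⟩

theorem cup₃_mem (I J K : List (Fin n.T)) :
    n.cup₃ (pdList I) (pdList J) (pdList K) ∈ n.diff3 :=
  Submodule.subset_span ⟨I, J, K, rfl⟩

theorem pd_diff2 (i : Fin n.T) {D : n.C2} (hD : D ∈ n.diff2) : D.compr₂ (pd i) ∈ n.diff2 := by
  induction hD using Submodule.span_induction with
  | mem D h =>
    obtain ⟨I, J, rfl⟩ := h
    have : (n.cup (pdList I) (pdList J)).compr₂ (pd i)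
        = n.cup (pdList I) (pdList (i :: J)) + n.cup (pdList (i :: I)) (pdList J) := by
      refine LinearMap.ext fun f => LinearMap.ext fun g => ?_
      simp [cup_apply, pd_mul, pdList_cons]
    rw [this]
    exact add_mem (n.cup_mem _ _) (n.cup_mem _ _)
  | zero =>
    have : (0 : n.C2).compr₂ (pd i) = 0 :=
      LinearMap.ext fun f => LinearMap.ext fun g => map_zero (pd i)
    rw [this]
    exact zero_mem n.diff2
  | add D E _ _ hD hE =>
    have : (D + E).compr₂ (pd i) = D.compr₂ (pd i) + E.compr₂ (pd i) :=
      LinearMap.ext fun f => LinearMap.ext fun g => map_add (pd i) _ _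
    rw [this]
    exact add_mem hD hE
  | smul c D hD h =>
    have : (c • D).compr₂ (pd i) = c • D.compr₂ (pd i) + pd i c • D := by
      refine LinearMap.ext fun f => LinearMap.ext fun g => ?_
      simp [pd_mul]
    rw [this]
    exact add_mem (n.diff2.smul_mem _ h) (n.diff2.smul_mem _ hD)

/-- The higher product rule: `(f, g) ↦ ∂_I (f g)` is a bidifferential operator. -/
theorem pdList_mul_mem (I : List (Fin n.T)) :
    (LinearMap.mul ℝ n.A).compr₂ (pdList I) ∈ n.diff2 := by
  induction I with
  | nil => exact n.cup_mem [] []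
  | cons i I ih =>
    rw [pdList_cons]
    exact n.pd_diff2 i ih

theorem δ₁_smul (c : n.A) (D : n.C1) : n.δ₁ (c • D) = c • n.δ₁ D := by
  refine LinearMap.ext fun f => LinearMap.ext fun g => ?_
  simp only [δ₁_apply, LinearMap.smul_apply, smul_eq_mul]
  ring

theorem δ₁_diff {D : n.C1} (hD : D ∈ n.diff1) : n.δ₁ D ∈ n.diff2 := by
  induction hD using Submodule.span_induction with
  | mem D h =>
    obtain ⟨I, rfl⟩ := h
    exact add_mem (sub_mem (n.cup_mem [] I) (n.pdList_mul_mem I)) (n.cup_mem I [])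
  | zero => rw [map_zero]; exact zero_mem n.diff2
  | add D E _ _ hD hE => rw [map_add]; exact add_mem hD hE
  | smul c D hD h => rw [δ₁_smul]; exact n.diff2.smul_mem _ h

theorem δ₂_smul (c : n.A) (D : n.C2) : n.δ₂ (c • D) = c • n.δ₂ D := by
  refine LinearMap.ext fun f => LinearMap.ext fun g => LinearMap.ext fun h => ?_
  simp only [δ₂_apply, LinearMap.smul_apply, smul_eq_mul]
  ring

theorem exists_diff3_right {D : n.C2} (hD : D ∈ n.diff2) (J : List (Fin n.T)) :
    ∃ E ∈ n.diff3, ∀ f g h, E f g h = D f g * pdList J h := by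
  induction hD using Submodule.span_induction with
  | mem D h =>
    obtain ⟨I, I', rfl⟩ := h
    exact ⟨_, n.cup₃_mem I I' J, fun _ _ _ => rfl⟩
  | zero => exact ⟨0, zero_mem n.diff3, fun _ _ _ => by simp⟩
  | add D E _ _ hD hE =>
    obtain ⟨D', hD, h1⟩ := hD
    obtain ⟨E', hE, h2⟩ := hE
    exact ⟨D' + E', add_mem hD hE, fun _ _ _ => by simp [h1, h2, add_mul]⟩
  | smul c D hD h =>
    obtain ⟨D', hD, h1⟩ := h
    exact ⟨c • D', n.diff3.smul_mem _ hD, fun _ _ _ => by simp [h1, mul_assoc]⟩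

theorem exists_diff3_left {D : n.C2} (hD : D ∈ n.diff2) (J : List (Fin n.T)) :
    ∃ E ∈ n.diff3, ∀ f g h, E f g h = pdList J f * D g h := by
  induction hD using Submodule.span_induction with
  | mem D h =>
    obtain ⟨I, I', rfl⟩ := h
    exact ⟨_, n.cup₃_mem J I I', fun _ _ _ => by simp [cup₃_apply, cup_apply, mul_assoc]⟩
  | zero => exact ⟨0, zero_mem n.diff3, fun _ _ _ => by simp⟩
  | add D E _ _ hD hE =>
    obtain ⟨D', hD, h1⟩ := hD
    obtain ⟨E', hE, h2⟩ := hE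
    exact ⟨D' + E', add_mem hD hE, fun _ _ _ => by simp [h1, h2, mul_add]⟩
  | smul c D hD h =>
    obtain ⟨D', hD, h1⟩ := h
    exact ⟨c • D', n.diff3.smul_mem _ hD, fun _ _ _ => by simp [h1, mul_left_comm]⟩

theorem δ₂_diff {D : n.C2} (hD : D ∈ n.diff2) : n.δ₂ D ∈ n.diff3 := by
  induction hD using Submodule.span_induction with
  | mem D h =>
    obtain ⟨I, J, rfl⟩ := h
    obtain ⟨E₁, h₁, e₁⟩ := n.exists_diff3_right (n.pdList_mul_mem I) J
    obtain ⟨E₂, h₂, e₂⟩ := n.exists_diff3_left (n.pdList_mul_mem J) I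
    have : n.δ₂ (n.cup (pdList I) (pdList J))
        = n.cup₃ (pdList []) (pdList I) (pdList J) - E₁ + E₂
          - n.cup₃ (pdList I) (pdList J) (pdList []) := by
      refine LinearMap.ext fun f => LinearMap.ext fun g => LinearMap.ext fun h => ?_
      change _ = f * pdList I g * pdList J h - E₁ f g h + E₂ f g h - pdList I f * pdList J g * h
      simp [δ₂_apply, cup_apply, e₁, e₂, mul_assoc]
    rw [this]
    exact sub_mem (add_mem (sub_mem (n.cup₃_mem _ _ _) h₁) h₂) (n.cup₃_mem _ _ _)
  | zero => rw [map_zero]; exact zero_mem n.diff3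
  | add D E _ _ hD hE => rw [map_add]; exact add_mem hD hE
  | smul c D hD h => rw [δ₂_smul]; exact n.diff3.smul_mem _ h

theorem pd_fnZ {f : n.A} (hf : f ∈ n.fnZ) (i : Fin n.T) (hi : i < n.N) : pd i f ∈ n.fnZ := by
  intro x hx
  have h1 : HasDerivAt (fun t : ℝ => x + t • (Pi.single i 1 : Fin n.T → ℝ))
      (Pi.single i 1) 0 := by
    simpa using ((hasDerivAt_id (0 : ℝ)).smul_const (Pi.single i 1 : Fin n.T → ℝ)).const_add x
  have h2 : HasFDerivAt (f : (Fin n.T → ℝ) → ℝ) (fderiv ℝ f x)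
      (x + (0 : ℝ) • (Pi.single i 1 : Fin n.T → ℝ)) := by
    simpa using (f.differentiableAt x).hasFDerivAt
  have h3 := h2.comp_hasDerivAt (0 : ℝ) h1
  have h4 : ((f : (Fin n.T → ℝ) → ℝ) ∘ fun t : ℝ => x + t • (Pi.single i 1 : Fin n.T → ℝ))
      = fun _ => 0 := by
    funext t
    refine hf _ fun j hj => ?_
    have hij : j ≠ i := by
      rintro rfl
      exact absurd hi (not_lt.2 hj)
    simp [hx j hj, hij]
  rw [h4] at h3
  exact h3.unique (hasDerivAt_const (0 : ℝ) (0 : ℝ))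

theorem fnZ_le {f : n.A} (hf : f ∈ n.fnZ) : f ∈ n.fnN :=
  fun i hi => n.pd_fnZ hf i (hi.trans_le n.hZN)

theorem mul_fnZ_left {f g : n.A} (hf : f ∈ n.fnZ) : f * g ∈ n.fnZ := Ideal.mul_mem_right _ _ hf

theorem mul_fnZ_right {f g : n.A} (hg : g ∈ n.fnZ) : f * g ∈ n.fnZ := Ideal.mul_mem_left _ _ hg

theorem δ₁_N {D : n.C1} (hD : D ∈ n.diff1N) : n.δ₁ D ∈ n.diff2N := by
  obtain ⟨h, hN, hZ⟩ := hD
  refine ⟨n.δ₁_diff h, fun f hf g hg => ?_, fun f hf g hg => ?_, fun f hf g hg => ?_⟩ <;>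
    rw [δ₁_apply]
  · exact add_mem (sub_mem (mul_mem hf (hN g hg)) (hN _ (mul_mem hf hg))) (mul_mem (hN f hf) hg)
  · exact add_mem (sub_mem (n.mul_fnZ_left hf) (hZ _ (n.mul_fnZ_left hf)))
      (n.mul_fnZ_left (hZ f hf))
  · exact add_mem (sub_mem (n.mul_fnZ_right (hZ g hg)) (hZ _ (n.mul_fnZ_right hg)))
      (n.mul_fnZ_right hg)

theorem δ₁_Z {D : n.C1} (hD : D ∈ n.diff1Z) : n.δ₁ D ∈ n.diff2Z := by
  obtain ⟨h, hZ⟩ := hD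
  refine ⟨n.δ₁_N h, fun f hf g hg => ?_⟩
  rw [δ₁_apply]
  exact add_mem (sub_mem (n.mul_fnZ_right (hZ g hg)) (hZ _ (mul_mem hf hg)))
    (n.mul_fnZ_left (hZ f hf))

theorem δ₂_N {D : n.C2} (hD : D ∈ n.diff2N) : n.δ₂ D ∈ n.diff3N := by
  obtain ⟨hd, hN, hL, hR⟩ := hD
  refine ⟨n.δ₂_diff hd, fun f hf g hg h hh => ?_, fun f hf g hg h hh => ?_,
    fun f hf g hg h hh => ?_, fun f hf g hg h hh => ?_⟩ <;> rw [δ₂_apply]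
  · exact sub_mem (add_mem (sub_mem (mul_mem hf (hN _ hg _ hh)) (hN _ (mul_mem hf hg) _ hh))
      (hN _ hf _ (mul_mem hg hh))) (mul_mem (hN _ hf _ hg) hh)
  · exact sub_mem (add_mem (sub_mem (n.mul_fnZ_left hf) (hL _ (n.mul_fnZ_left hf) _ hh))
      (hL _ hf _ (mul_mem hg hh))) (n.mul_fnZ_left (hL _ hf _ hg))
  · exact sub_mem (add_mem (sub_mem (n.mul_fnZ_right (hL _ hg _ hh))
      (hL _ (n.mul_fnZ_right hg) _ hh)) (hR _ hf _ (n.mul_fnZ_left hg)))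
      (n.mul_fnZ_left (hR _ hf _ hg))
  · exact sub_mem (add_mem (sub_mem (n.mul_fnZ_right (hR _ hg _ hh))
      (hR _ (mul_mem hf hg) _ hh)) (hR _ hf _ (n.mul_fnZ_right hh))) (n.mul_fnZ_right hh)

theorem δ₂_Z {D : n.C2} (hD : D ∈ n.diff2Z) : n.δ₂ D ∈ n.diff3Z := by
  obtain ⟨h, hZ⟩ := hD
  refine ⟨n.δ₂_N h, fun f hf g hg h hh => ?_⟩
  rw [δ₂_apply]
  exact sub_mem (add_mem (sub_mem (n.mul_fnZ_right (hZ _ hg _ hh)) (hZ _ (mul_mem hf hg) _ hh))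
    (hZ _ hf _ (mul_mem hg hh))) (n.mul_fnZ_left (hZ _ hf _ hg))

theorem δ₂_δ₁ (D : n.C1) : n.δ₂ (n.δ₁ D) = 0 := by
  refine LinearMap.ext fun f => LinearMap.ext fun g => LinearMap.ext fun h => ?_
  simp only [δ₂_apply, δ₁_apply, LinearMap.zero_apply, mul_assoc]
  ring

/-- The Hochschild differential `C^1_diff → C^2_diff` as a morphism of constraint modules. -/
def d₁ : ConModule.Hom n.cochain1 n.cochain2 where
  T := n.δ₁.restrict (p := n.diff1.restrictScalars ℝ) (q := n.diff2.restrictScalars ℝ)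
    fun _ h => n.δ₁_diff h
  N := n.δ₁.restrict (p := n.diff1N) (q := n.diff2N) fun _ h => n.δ₁_N h
  comm _ := rfl
  map_Z _ h := n.δ₁_Z h

/-- The Hochschild differential `C^2_diff → C^3_diff` as a morphism of constraint modules. -/
def d₂ : ConModule.Hom n.cochain2 n.cochain3 where
  T := n.δ₂.restrict (p := n.diff2.restrictScalars ℝ) (q := n.diff3.restrictScalars ℝ)
    fun _ h => n.δ₂_diff h
  N := n.δ₂.restrict (p := n.diff2N) (q := n.diff3N) fun _ h => n.δ₂_N h
  comm _ := rfl
  map_Z _ h := n.δ₂_Z h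

/-- The differential second constraint Hochschild cohomology `HH²_diff(C^∞(ℝ^n))`. -/
def HH2 : ConModule ℝ :=
  ConModule.cohomology n.d₁ n.d₂ (fun D => Subtype.ext (n.δ₂_δ₁ D.1))
    (fun D => Subtype.ext (n.δ₂_δ₁ D.1))

/-! ### The extended constraint HKR map -/

/-- The HKR map on cochains:
`U(π)(f, g) = ½ π(df, dg) = ½ ∑ π^{ij} ∂_i f ∂_j g`. -/
def hkr : (Fin n.T → Fin n.T → n.A) →ₗ[ℝ] n.C2 where
  toFun π := (2⁻¹ : ℝ) • ∑ i, ∑ j, π i j • n.cup (pd i) (pd j)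
  map_add' π ρ := by
    simp only [Pi.add_apply, add_smul, Finset.sum_add_distrib, smul_add]
  map_smul' c π := by
    simp only [Pi.smul_apply, smul_assoc, ← Finset.smul_sum, RingHom.id_apply]
    rw [smul_comm]

theorem hkr_diff (π : Fin n.T → Fin n.T → n.A) : n.hkr π ∈ n.diff2 := by
  refine (n.diff2.restrictScalars ℝ).smul_mem _ (sum_mem fun i _ => sum_mem fun j _ => ?_)
  refine n.diff2.smul_mem _ ?_
  have := n.cup_mem [i] [j]
  rwa [pdList_single, pdList_single] at this

theorem hkr_closed (π : Fin n.T → Fin n.T → n.A) : n.δ₂ (n.hkr π) = 0 := by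
  have key : ∀ i j, n.δ₂ (n.cup (pd i) (pd j)) = 0 := fun i j => by
    refine LinearMap.ext fun f => LinearMap.ext fun g => LinearMap.ext fun h => ?_
    simp only [δ₂_apply, cup_apply, LinearMap.zero_apply, pd_mul]
    ring
  change n.δ₂ ((2⁻¹ : ℝ) • ∑ i, ∑ j, π i j • n.cup (pd i) (pd j)) = 0
  simp only [map_smul, map_sum, δ₂_smul, key, smul_zero, Finset.sum_const_zero]

/-- The Lie derivative of a function along a vector field. -/
def lie (X : n.Vec) (f : n.A) : n.A := ∑ i, X i * pd i f

theorem hkr_wedge (X Y : n.Vec) (f g : n.A) :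
    n.hkr (n.wedge X Y) f g = (2⁻¹ : ℝ) • (n.lie X f * n.lie Y g - n.lie Y f * n.lie X g) := by
  change ((2⁻¹ : ℝ) • ∑ i, ∑ j, n.wedge X Y i j • n.cup (pd i) (pd j)) f g = _
  simp only [LinearMap.smul_apply, LinearMap.sum_apply, cup_apply, lie, Finset.sum_mul_sum,
    ← Finset.sum_sub_distrib, wedge, smul_eq_mul]
  congr 1
  refine Finset.sum_congr rfl fun i _ => Finset.sum_congr rfl fun j _ => ?_
  ring

theorem lie_Z_N {X : n.Vec} (hX : X ∈ n.vecZ) {f : n.A} (hf : f ∈ n.fnN) : n.lie X f ∈ n.fnZ := by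
  refine sum_mem fun i _ => ?_
  by_cases hi : i < n.Z
  · exact n.mul_fnZ_right (hf i hi)
  · exact n.mul_fnZ_left (hX i (not_lt.1 hi))

theorem lie_N_Z {X : n.Vec} (hX : X ∈ n.vecN) {f : n.A} (hf : f ∈ n.fnZ) : n.lie X f ∈ n.fnZ := by
  refine sum_mem fun i _ => ?_
  by_cases hi : i < n.N
  · exact n.mul_fnZ_right (n.pd_fnZ hf i hi)
  · exact n.mul_fnZ_left (hX.1 i (not_lt.1 hi))

theorem lie_N_N {X : n.Vec} (hX : X ∈ n.vecN) {f : n.A} (hf : f ∈ n.fnN) : n.lie X f ∈ n.fnN := by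
  intro j hj
  rw [lie, map_sum]
  refine sum_mem fun i _ => ?_
  rw [pd_mul]
  refine add_mem ?_ ?_
  · by_cases hi : i < n.N
    · rw [pd_comm]
      exact n.mul_fnZ_right (n.pd_fnZ (hf j hj) i hi)
    · exact n.mul_fnZ_left (hX.1 i (not_lt.1 hi))
  · by_cases hi : i < n.Z
    · exact n.mul_fnZ_right (hf i hi)
    · exact n.mul_fnZ_left (hX.2 j hj i (not_lt.1 hi))

theorem hkr_Z {π : Fin n.T → Fin n.T → n.A} (hπ : π ∈ n.bivZ) : n.hkr π ∈ n.diff2Z := by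
  have key : n.bivZ ≤ n.diff2Z.comap n.hkr := by
    refine Submodule.span_le.2 ?_
    rintro _ ⟨X, hX, Y, rfl⟩
    have h : ∀ f ∈ n.fnN, ∀ g ∈ n.fnN, n.hkr (n.wedge X Y) f g ∈ n.fnZ := fun f hf g hg => by
      rw [hkr_wedge]
      exact (n.fnZ.restrictScalars ℝ).smul_mem _ (sub_mem (n.mul_fnZ_left (n.lie_Z_N hX hf))
        (n.mul_fnZ_right (n.lie_Z_N hX hg)))
    exact ⟨⟨n.hkr_diff _, fun f hf g hg => n.fnZ_le (h f hf g hg),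
      fun f hf g hg => h f (n.fnZ_le hf) g hg, fun f hf g hg => h f hf g (n.fnZ_le hg)⟩, h⟩
  exact key hπ

theorem hkr_N {π : Fin n.T → Fin n.T → n.A} (hπ : π ∈ n.bivN) : n.hkr π ∈ n.diff2N := by
  have key : n.bivN ≤ n.diff2N.comap n.hkr := by
    refine sup_le (Submodule.span_le.2 ?_) fun π hπ => (n.hkr_Z hπ).1
    rintro _ ⟨X, hX, Y, hY, rfl⟩
    refine ⟨n.hkr_diff _, fun f hf g hg => ?_, fun f hf g hg => ?_, fun f hf g hg => ?_⟩ <;>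
      rw [hkr_wedge]
    · exact n.fnN.smul_mem (sub_mem (mul_mem (n.lie_N_N hX hf) (n.lie_N_N hY hg))
        (mul_mem (n.lie_N_N hY hf) (n.lie_N_N hX hg))) _
    · exact (n.fnZ.restrictScalars ℝ).smul_mem _ (sub_mem (n.mul_fnZ_left (n.lie_N_Z hX hf))
        (n.mul_fnZ_left (n.lie_N_Z hY hf)))
    · exact (n.fnZ.restrictScalars ℝ).smul_mem _ (sub_mem (n.mul_fnZ_right (n.lie_N_Z hY hg))
        (n.mul_fnZ_right (n.lie_N_Z hX hg)))
  exact key hπ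

theorem pdPow_eq {m : ℕ} (k : Fin m →₀ ℕ) : ∃ I, pdPow k = pdList I := by
  refine ⟨(List.ofFn fun i => List.replicate (k i) i).flatten, ?_⟩
  simp only [pdPow, pdList, List.map_flatten, List.prod_flatten, List.map_ofFn]
  congr 2
  funext i
  simp

theorem prod_map_pow_add_single {M : Type} [Monoid M] {m : ℕ} (a : Fin m → M)
    (ha : ∀ i j, Commute (a i) (a j)) (k : Fin m →₀ ℕ) (i : Fin m) (L : List (Fin m)) :
    (L.map fun j => a j ^ (k + Finsupp.single i 1 : Fin m →₀ ℕ) j).prod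
      = (L.map fun j => a j ^ k j).prod * a i ^ L.count i := by
  induction L with
  | nil => simp
  | cons j L ih =>
    have hP : Commute (a i) (L.map fun j => a j ^ k j).prod := by
      refine Commute.list_prod_right _ _ fun y hy => ?_
      obtain ⟨l, -, rfl⟩ := List.mem_map.1 hy
      exact (ha i l).pow_right _
    rw [List.map_cons, List.prod_cons, ih, List.map_cons, List.prod_cons]
    by_cases h : j = i
    · subst h
      rw [List.count_cons_self, Finsupp.add_apply, Finsupp.single_eq_same, pow_succ, mul_assoc,
        ← mul_assoc (a j), hP.eq, pow_succ', mul_assoc, mul_assoc]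
    · rw [List.count_cons_of_ne h, Finsupp.add_apply, Finsupp.single_eq_of_ne h, add_zero,
        mul_assoc]

theorem pdPow_add_single {m : ℕ} (k : Fin m →₀ ℕ) (i : Fin m) :
    pdPow (k + Finsupp.single i 1) = pdPow k ∘ₗ pd i := by
  have h := prod_map_pow_add_single (fun j : Fin m => (pd j : Module.End ℝ (Smooth m)))
    (fun a b => LinearMap.ext fun f => pd_comm a b f) k i (List.finRange m)
  rw [List.count_eq_one_of_mem (List.nodup_finRange m) (List.mem_finRange i), pow_one] at h
  simp only [pdPow, List.ofFn_eq_map]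
  exact h

theorem opSymbol_monomial {m : ℕ} (k : Fin m →₀ ℕ) (c : Smooth m) :
    opSymbol m (MvPolynomial.monomial k c) = c • pdPow k := by
  have : MvPolynomial.monomial k c
      = c • MvPolynomial.basisMonomials (Fin m) (Smooth m) k := by
    simp [MvPolynomial.smul_monomial]
  rw [this, map_smul, opSymbol, Module.Basis.constr_basis]

theorem opSymbol_mul_X {m : ℕ} (P : MvPolynomial (Fin m) (Smooth m)) (i : Fin m) :
    opSymbol m (P * MvPolynomial.X i) = opSymbol m P ∘ₗ pd i := by
  induction P using MvPolynomial.induction_on' with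
  | monomial k c =>
    rw [MvPolynomial.X, MvPolynomial.monomial_mul, mul_one, opSymbol_monomial, opSymbol_monomial,
      pdPow_add_single]
    rfl
  | add P Q hP hQ => rw [add_mul, map_add, map_add, hP, hQ, LinearMap.add_comp]

theorem opSymbol_diff (P : MvPolynomial (Fin n.T) n.A) : opSymbol n.T P ∈ n.diff1 := by
  induction P using MvPolynomial.induction_on' with
  | monomial k c =>
    rw [opSymbol_monomial]
    exact n.diff1.smul_mem _ (Submodule.subset_span (pdPow_eq k))
  | add P Q hP hQ => rw [map_add]; exact add_mem hP hQ

theorem prol_mul_X (P : n.SymC) (i : Fin n.T) :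
    n.prol (P * MvPolynomial.X i) = n.prol P * MvPolynomial.X i := by
  change MvPolynomial.map _ _ = MvPolynomial.map _ _ * _
  rw [map_mul, MvPolynomial.map_X]

theorem prol_smul (b : n.B) (P : n.SymC) : n.prol (b • P) = n.prolFn b • n.prol P := by
  change MvPolynomial.map _ _ = _ • MvPolynomial.map _ _
  rw [MvPolynomial.smul_eq_C_mul, map_mul, MvPolynomial.map_C, MvPolynomial.smul_eq_C_mul]
  rfl

/-- The differential operator `Op(prol(P))`. -/
def opProl : n.SymC →ₗ[ℝ] n.C1 := (opSymbol n.T).restrictScalars ℝ ∘ₗ n.prol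

theorem opProl_smul (b : n.B) (P : n.SymC) : n.opProl (b • P) = n.prolFn b • n.opProl P := by
  change opSymbol n.T (n.prol (b • P)) = _ • opSymbol n.T (n.prol P)
  rw [prol_smul, map_smul]

theorem opProl_mul_X (P : n.SymC) (i : Fin n.T) :
    n.opProl (P * MvPolynomial.X i) = n.opProl P ∘ₗ pd i := by
  change opSymbol n.T (n.prol (P * MvPolynomial.X i)) = opSymbol n.T (n.prol P) ∘ₗ _
  rw [prol_mul_X, opSymbol_mul_X]

theorem opProl_one (f : n.A) : n.opProl 1 f = f := by
  change opSymbol n.T (MvPolynomial.map _ (MvPolynomial.monomial 0 1)) f = f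
  rw [MvPolynomial.map_monomial, map_one, opSymbol_monomial, one_smul]
  have : pdPow (0 : Fin n.T →₀ ℕ) = LinearMap.id := by
    simp [pdPow]
    rfl
  rw [this]
  rfl

/-- Symbols whose operators preserve `C^∞(ℝ^n)_0` and are linear over `C^∞(ℝ^n)_N` modulo
`C^∞(ℝ^n)_0`. -/
def goodSym : Submodule n.B n.SymC where
  carrier := {P | (∀ f ∈ n.fnZ, n.opProl P f ∈ n.fnZ) ∧
    ∀ h, ∀ g ∈ n.fnN, n.opProl P (h * g) - n.opProl P h * g ∈ n.fnZ}
  add_mem' {P Q} hP hQ := ⟨fun f hf => by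
    rw [map_add]
    exact add_mem (hP.1 f hf) (hQ.1 f hf), fun h g hg => by
    have := add_mem (hP.2 h g hg) (hQ.2 h g hg)
    rw [map_add, LinearMap.add_apply, LinearMap.add_apply, add_mul, add_sub_add_comm]
    exact this⟩
  zero_mem' := ⟨fun f _ => by simp, fun h g _ => by simp⟩
  smul_mem' b P hP := ⟨fun f hf => by
    rw [opProl_smul]
    exact n.mul_fnZ_right (hP.1 f hf), fun h g hg => by
    have : n.opProl (b • P) (h * g) - n.opProl (b • P) h * g
        = n.prolFn b * (n.opProl P (h * g) - n.opProl P h * g) := by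
      simp only [opProl_smul, LinearMap.smul_apply, smul_eq_mul]
      ring
    rw [this]
    exact n.mul_fnZ_right (hP.2 h g hg)⟩

theorem symDist_pow_le (k : ℕ) : n.symDist ^ k ≤ n.goodSym := by
  induction k with
  | zero =>
    rw [pow_zero, Submodule.one_le]
    exact ⟨fun f hf => by rwa [opProl_one], fun h g _ => by simp [opProl_one]⟩
  | succ k ih =>
    rw [pow_succ, Submodule.mul_le]
    intro P hP Q hQ
    have hP := ih hP
    induction hQ using Submodule.span_induction with
    | mem Q hQ =>
      obtain ⟨i, hi, rfl⟩ := hQ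
      refine ⟨fun f hf => ?_, fun h g hg => ?_⟩
      · rw [opProl_mul_X]
        exact hP.1 _ (n.pd_fnZ hf i (hi.trans_le n.hZN))
      · have : n.opProl (P * MvPolynomial.X i) (h * g) - n.opProl (P * MvPolynomial.X i) h * g
            = n.opProl P (h * pd i g) + (n.opProl P (pd i h * g) - n.opProl P (pd i h) * g) := by
          rw [opProl_mul_X, LinearMap.comp_apply, LinearMap.comp_apply, pd_mul, map_add]
          ring
        rw [this]
        exact add_mem (hP.1 _ (n.mul_fnZ_right (hg i hi))) (hP.2 _ _ hg)
    | zero => rw [mul_zero]; exact zero_mem _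
    | add Q R _ _ hQ hR => rw [mul_add]; exact add_mem hQ hR
    | smul b Q _ hQ => rw [mul_smul_comm]; exact n.goodSym.smul_mem b hQ

/-- Symbols whose operators are derivations on `C^∞(ℝ^n)_N` modulo `C^∞(ℝ^n)_0`. -/
def derSym : Submodule n.B n.SymC where
  carrier := {P | ∀ f ∈ n.fnN, ∀ g ∈ n.fnN, n.δ₁ (n.opProl P) f g ∈ n.fnZ}
  add_mem' {P Q} hP hQ f hf g hg := by
    rw [map_add, map_add]
    exact add_mem (hP f hf g hg) (hQ f hf g hg)
  zero_mem' f _ g _ := by rw [map_zero, map_zero]; exact zero_mem _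
  smul_mem' b P hP f hf g hg := by
    rw [opProl_smul, δ₁_smul]
    exact n.mul_fnZ_right (hP f hf g hg)

theorem extSym_le : n.extSym ≤ n.derSym := by
  refine iSup_le fun k => Submodule.mul_le.2 fun P hP Q hQ => ?_
  have hP := n.symDist_pow_le _ hP
  induction hQ using Submodule.span_induction with
  | mem Q hQ =>
    obtain ⟨i, -, rfl⟩ := hQ
    intro f hf g hg
    have : n.δ₁ (n.opProl (P * MvPolynomial.X i)) f g
        = -(n.opProl P (pd i g * f) - n.opProl P (pd i g) * f)
          - (n.opProl P (pd i f * g) - n.opProl P (pd i f) * g) := by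
      rw [opProl_mul_X, δ₁_apply, LinearMap.comp_apply, LinearMap.comp_apply,
        LinearMap.comp_apply, pd_mul, map_add, mul_comm f (pd i g)]
      ring
    rw [this]
    exact sub_mem (neg_mem (hP.2 _ _ hf)) (hP.2 _ _ hg)
  | zero => rw [mul_zero]; exact zero_mem _
  | add Q R _ _ hQ hR => rw [mul_add]; exact add_mem hQ hR
  | smul b Q _ hQ => rw [mul_smul_comm]; exact n.derSym.smul_mem b hQ

theorem δ₁_opProl_Z {P : n.SymC} (hP : P ∈ n.extSym) : n.δ₁ (n.opProl P) ∈ n.diff2Z := by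
  have h := n.extSym_le hP
  exact ⟨⟨n.δ₁_diff (n.opSymbol_diff _), fun f hf g hg => n.fnZ_le (h f hf g hg),
    fun f hf g hg => h f (n.fnZ_le hf) g hg, fun f hf g hg => h f hf g (n.fnZ_le hg)⟩, h⟩

/-- The `T`-component of the extended HKR map on cochains, `π ↦ U(π)`. -/
def hkrExtT : n.biv →ₗ[ℝ] LinearMap.ker n.d₂.T :=
  LinearMap.codRestrict (LinearMap.ker n.d₂.T)
    (LinearMap.codRestrict (n.diff2.restrictScalars ℝ) (n.hkr ∘ₗ n.biv.subtype)
      fun π => n.hkr_diff π)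
    fun π => Subtype.ext (n.hkr_closed π)

/-- The `N`-component of the extended HKR map on cochains, `(π, P) ↦ U(π) + δ(Op(prol(P)))`. -/
def hkrExtN : (n.bivN × n.extSym) →ₗ[ℝ] LinearMap.ker n.d₂.N :=
  LinearMap.codRestrict (LinearMap.ker n.d₂.N)
    (LinearMap.codRestrict n.diff2N
      ((n.hkr ∘ₗ n.bivN.subtype).coprod
        (n.δ₁ ∘ₗ n.opProl ∘ₗ (n.extSym.restrictScalars ℝ).subtype))
      fun q => add_mem (n.hkr_N q.1.2) (n.δ₁_opProl_Z q.2.2).1)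
    fun q => Subtype.ext (by
      change n.δ₂ (n.hkr q.1 + n.δ₁ (n.opProl q.2)) = 0
      rw [map_add, hkr_closed, δ₂_δ₁, add_zero])

/-- The extended constraint HKR map `𝔛²_ext(ℝ^n) → HH²_diff(C^∞(ℝ^n))`, given by
`π ↦ [U(π)]` on `T`-components and `(π, P) ↦ [U(π) + δ(Op(prol(P)))]` on `N`-components. -/
def hkrExt : ConModule.Hom n.bivExt n.HH2 where
  T := Submodule.mkQ _ ∘ₗ n.hkrExtT
  N := Submodule.mkQ _ ∘ₗ n.hkrExtN
  comm q := by
    refine (Submodule.Quotient.eq _).2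
      ⟨⟨n.opProl q.2, n.opSymbol_diff _⟩, Subtype.ext (Subtype.ext ?_)⟩
    change n.δ₁ (n.opProl q.2) = n.hkr q.1 + n.δ₁ (n.opProl q.2) - n.hkr q.1
    rw [add_sub_cancel_left]
  map_Z q hq := by
    refine ⟨n.hkrExtN q, ?_, rfl⟩
    exact add_mem (n.hkr_Z hq.1) (n.δ₁_opProl_Z q.2.2)

end ConDim
end

/-! Applied to exponentials `exp ⟨ξ, x⟩`, a differential operator is multiplication by its symbol,
and such values determine a bidifferential operator (`diff2_ext`). At a fixed point `x`, a closed
bidifferential operator with symbol `Φ(ξ, η)` is therefore a polynomial two-cocycle on the additive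
group of covectors, and the coboundary of an operator with symbol `S` has symbol `S(η) - S(ξ + η) +
S(ξ)`. Unconstrained case (`exists_hkr_add_coboundary`): choose `S` so that subtracting its
coboundary makes the diagonal `Φ(ξ, ξ)` additive in `ξ`. On homogeneous parts of degree `d ≠ 1` this
is a division by `2 - 2^d`, and degree one is already additive. The symmetric part of the corrected
cocycle then scales by `2` under `(ξ, η) ↦ (2ξ, 2η)`; being differentiable it is linear on pairs,
and the cocycle identity forces it to vanish. The antisymmetric part is bilinear, so it is a
bivector field. Coboundaries are symmetric, so this bivector field is recovered by antisymmetrizing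
and testing on coordinate functions. The same test shows that constraint cocycles have constraint
bivector parts (`bivN_of_cochain`, `bivZ_of_cochain`). Constrained case: the remaining coboundary
`δ(Op S)` may be a constraint cochain although `Op S` is not. Commutation with `x^j` differentiates
the symbol (`opSymbol_pderiv`), which turns invariance of an ideal or subalgebra into conditions on
coefficients. If `S` has no linear part, the only coefficients with a normal index that need not
vanish on `C` belong to exponents `a + e_i` with `i` normal and `a ≠ 0` along the distribution.
These are the monomials of the extra summand. Subtracting their prolonged restrictions to `C` leaves
a constraint operator (`exists_opProl_add`), which gives surjectivity. Conversely, such an extra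
term can bound in the constraint complex only if its coefficients vanish on `C`, hence identically
(`eq_zero_of_δ₁_opProl`), which gives injectivity. -/

noncomputable section

/-! ### Symbols of differential operators -/

/-- Evaluation at a point, as a ring homomorphism. -/
def Smooth.evalHom {m : ℕ} (x : Fin m → ℝ) : Smooth m →+* ℝ where
  toFun f := f x
  map_one' := rfl
  map_mul' _ _ := rfl
  map_zero' := rfl
  map_add' _ _ := rfl

/-- The exponential function `x ↦ exp ⟨ξ, x⟩`. -/
def expo {m : ℕ} (ξ : Fin m → ℝ) : Smooth m :=
  ⟨fun x => Real.exp (∑ i, ξ i * x i), show ContDiff ℝ ∞ _ from ContDiff.exp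
    (ContDiff.sum fun i _ => contDiff_const.mul (contDiff_apply ℝ ℝ i))⟩

theorem expo_apply {m : ℕ} (ξ x : Fin m → ℝ) : expo ξ x = Real.exp (∑ i, ξ i * x i) := rfl

theorem expo_ne_zero {m : ℕ} (ξ x : Fin m → ℝ) : expo ξ x ≠ 0 := (Real.exp_pos _).ne'

theorem expo_add {m : ℕ} (ξ η : Fin m → ℝ) : expo (ξ + η) = expo ξ * expo η := by
  refine Smooth.ext fun x => ?_
  simp only [Smooth.mul_apply, expo_apply, ← Real.exp_add, Pi.add_apply, add_mul,
    Finset.sum_add_distrib]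

theorem pd_expo {m : ℕ} (i : Fin m) (ξ : Fin m → ℝ) : pd i (expo ξ) = ξ i • expo ξ := by
  refine Smooth.ext fun x => ?_
  have h : HasFDerivAt (fun x : Fin m → ℝ => ∑ j, ξ j * x j)
      (∑ j, ξ j • (ContinuousLinearMap.proj j : (Fin m → ℝ) →L[ℝ] ℝ)) x :=
    HasFDerivAt.fun_sum fun j _ => (hasFDerivAt_apply j x).const_mul (ξ j)
  have h2 : fderiv ℝ (expo ξ : (Fin m → ℝ) → ℝ) x = _ := h.exp.fderiv
  rw [pd_apply, h2]
  simp [Smooth.smul_apply, expo_apply, Pi.single_apply, mul_comm]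

/-- The full symbol at the point `x` and the covector `ξ`. -/
def symbolAt {m : ℕ} {σ : Type} (x : Fin m → ℝ) (ξ : σ → ℝ) :
    MvPolynomial σ (Smooth m) →+* ℝ :=
  MvPolynomial.eval₂Hom (Smooth.evalHom x) ξ

theorem symbolAt_C {m : ℕ} {σ : Type} (x : Fin m → ℝ) (ξ : σ → ℝ) (c : Smooth m) :
    symbolAt x ξ (MvPolynomial.C c) = c x := MvPolynomial.eval₂Hom_C _ _ _

theorem symbolAt_X {m : ℕ} {σ : Type} (x : Fin m → ℝ) (ξ : σ → ℝ) (i : σ) :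
    symbolAt x ξ (MvPolynomial.X i) = ξ i := MvPolynomial.eval₂Hom_X' _ _ _

theorem symbolAt_monomial {m : ℕ} {σ : Type} (x : Fin m → ℝ) (ξ : σ → ℝ) (k : σ →₀ ℕ)
    (c : Smooth m) :
    symbolAt x ξ (MvPolynomial.monomial k c) = c x * k.prod fun i e => ξ i ^ e :=
  MvPolynomial.eval₂Hom_monomial _ _ _ _

/-- Freezing `x` leaves a real polynomial in `ξ`, and over an infinite field a polynomial is
determined by its values. -/
theorem eq_zero_of_symbolAt {m : ℕ} {σ : Type} {P : MvPolynomial σ (Smooth m)}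
    (h : ∀ x ξ, symbolAt x ξ P = 0) : P = 0 := by
  ext k : 1
  refine Smooth.ext fun x => ?_
  have : MvPolynomial.map (Smooth.evalHom x) P = 0 :=
    MvPolynomial.funext fun ξ => by
      rw [MvPolynomial.eval_map, map_zero]
      exact h x ξ
  have := congrArg (MvPolynomial.coeff k) this
  rwa [MvPolynomial.coeff_map] at this

theorem differentiable_symbolAt {m : ℕ} {σ : Type} [Fintype σ] (x : Fin m → ℝ)
    (P : MvPolynomial σ (Smooth m)) : Differentiable ℝ fun ξ : σ → ℝ => symbolAt x ξ P := by
  induction P using MvPolynomial.induction_on with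
  | C a => simp only [symbolAt_C]; fun_prop
  | add P Q hP hQ => simp only [map_add]; fun_prop
  | mul_X P i hP => simp only [map_mul, symbolAt_X]; fun_prop

theorem opSymbol_C {m : ℕ} (c f : Smooth m) : opSymbol m (MvPolynomial.C c) f = c * f := by
  have : pdPow (0 : Fin m →₀ ℕ) = LinearMap.id := by
    simp [pdPow]
    rfl
  rw [MvPolynomial.C_apply, ConDim.opSymbol_monomial, this]
  rfl

theorem opSymbol_expo {m : ℕ} (P : MvPolynomial (Fin m) (Smooth m)) (ξ x : Fin m → ℝ) :
    opSymbol m P (expo ξ) x = symbolAt x ξ P * expo ξ x := by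
  induction P using MvPolynomial.induction_on with
  | C a => rw [opSymbol_C, symbolAt_C, Smooth.mul_apply]
  | add P Q hP hQ => rw [map_add, map_add, LinearMap.add_apply, Smooth.add_apply, hP, hQ, add_mul]
  | mul_X P i hP =>
    rw [ConDim.opSymbol_mul_X, LinearMap.comp_apply, pd_expo, map_smul, Smooth.smul_apply, hP,
      map_mul, symbolAt_X]
    ring

theorem pdPow_expo {m : ℕ} (k : Fin m →₀ ℕ) (ξ x : Fin m → ℝ) :
    pdPow k (expo ξ) x = (∏ i, ξ i ^ k i) * expo ξ x := by
  have := opSymbol_expo (MvPolynomial.monomial k 1) ξ x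
  rw [ConDim.opSymbol_monomial, one_smul, symbolAt_monomial, Finsupp.prod_fintype _ _ (by simp)]
    at this
  rw [this]
  congr 1
  exact one_mul _

theorem exists_pdList_eq_pdPow {m : ℕ} (I : List (Fin m)) : ∃ k, pdList I = pdPow k := by
  induction I using List.reverseRecOn with
  | nil =>
    refine ⟨0, ?_⟩
    simp [pdPow, pdList]
  | append_singleton I i ih =>
    obtain ⟨k, hk⟩ := ih
    refine ⟨k + Finsupp.single i 1, ?_⟩
    rw [ConDim.pdPow_add_single, ← hk]
    simp [pdList, Module.End.mul_eq_comp]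

/-- The bidifferential operator with a given symbol. -/
def opSymbol₂ (n : ConDim) :
    MvPolynomial (Fin n.T ⊕ Fin n.T) n.A →ₗ[n.A] n.C2 :=
  (MvPolynomial.basisMonomials (Fin n.T ⊕ Fin n.T) n.A).constr n.A fun k =>
    n.cup (pdPow (Finsupp.sumFinsuppEquivProdFinsupp k).1)
      (pdPow (Finsupp.sumFinsuppEquivProdFinsupp k).2)

theorem opSymbol₂_monomial (n : ConDim) (k : Fin n.T ⊕ Fin n.T →₀ ℕ) (c : n.A) :
    opSymbol₂ n (MvPolynomial.monomial k c)
      = c • n.cup (pdPow (Finsupp.sumFinsuppEquivProdFinsupp k).1)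
        (pdPow (Finsupp.sumFinsuppEquivProdFinsupp k).2) := by
  have : MvPolynomial.monomial k c
      = c • MvPolynomial.basisMonomials (Fin n.T ⊕ Fin n.T) n.A k := by
    simp [MvPolynomial.smul_monomial]
  rw [this, map_smul, opSymbol₂, Module.Basis.constr_basis]

theorem opSymbol₂_expo (n : ConDim) (Q : MvPolynomial (Fin n.T ⊕ Fin n.T) n.A)
    (ξ η x : Fin n.T → ℝ) :
    opSymbol₂ n Q (expo ξ) (expo η) x = symbolAt x (Sum.elim ξ η) Q * (expo ξ x * expo η x) := by
  induction Q using MvPolynomial.induction_on' with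
  | monomial k c =>
    rw [opSymbol₂_monomial, symbolAt_monomial, Finsupp.prod_fintype _ _ (by simp),
      Fintype.prod_sum_type]
    change c x * (pdPow _ (expo ξ) x * pdPow _ (expo η) x) = _
    rw [pdPow_expo, pdPow_expo]
    simp only [Finsupp.fst_sumFinsuppEquivProdFinsupp, Finsupp.snd_sumFinsuppEquivProdFinsupp,
      Sum.elim_inl, Sum.elim_inr]
    ring
  | add P Q hP hQ =>
    rw [map_add, map_add, LinearMap.add_apply, LinearMap.add_apply, Smooth.add_apply, hP, hQ,
      add_mul]

theorem exists_opSymbol₂ {n : ConDim} {B : n.C2} (hB : B ∈ n.diff2) : ∃ Q, opSymbol₂ n Q = B := by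
  have : n.diff2 ≤ LinearMap.range (opSymbol₂ n) := by
    refine Submodule.span_le.2 ?_
    rintro _ ⟨I, J, rfl⟩
    obtain ⟨k, hk⟩ := exists_pdList_eq_pdPow I
    obtain ⟨l, hl⟩ := exists_pdList_eq_pdPow J
    refine ⟨MvPolynomial.monomial (Finsupp.sumFinsuppEquivProdFinsupp.symm (k, l)) 1, ?_⟩
    rw [opSymbol₂_monomial, one_smul, Equiv.apply_symm_apply, hk, hl]
  exact this hB

/-- A bidifferential operator is determined by its values on exponential functions. -/
theorem diff2_ext {n : ConDim} {B B' : n.C2} (hB : B ∈ n.diff2) (hB' : B' ∈ n.diff2)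
    (h : ∀ ξ η x, B (expo ξ) (expo η) x = B' (expo ξ) (expo η) x) : B = B' := by
  obtain ⟨Q, rfl⟩ := exists_opSymbol₂ hB
  obtain ⟨Q', rfl⟩ := exists_opSymbol₂ hB'
  have : Q - Q' = 0 := eq_zero_of_symbolAt fun x ζ => by
    have := h (ζ ∘ Sum.inl) (ζ ∘ Sum.inr) x
    rw [opSymbol₂_expo, opSymbol₂_expo, Sum.elim_comp_inl_inr] at this
    rw [map_sub, sub_eq_zero]
    exact mul_right_cancel₀ (mul_ne_zero (expo_ne_zero _ _) (expo_ne_zero _ _)) this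
  rw [sub_eq_zero.1 this]

/-! ### Polynomial two-cocycles on a vector space -/

/-- Along the points `2^{-k} v` the difference quotients of `G` at `0` all equal `G v`, so their
limit, the derivative in direction `v`, is `G v` itself. -/
theorem linear_of_map_two_smul {E : Type*} [NormedAddCommGroup E] [NormedSpace ℝ E] {G : E → ℝ}
    (hG : DifferentiableAt ℝ G 0) (h : ∀ v, G ((2 : ℝ) • v) = 2 * G v) (v : E) :
    G v = fderiv ℝ G 0 v := by
  have h0 : G 0 = 0 := by
    have := h 0
    rw [smul_zero] at this
    linarith
  have hp : ∀ (k : ℕ) v, G (((2 : ℝ) ^ k)⁻¹ • v) = ((2 : ℝ) ^ k)⁻¹ * G v := by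
    intro k v
    induction k with
    | zero => simp
    | succ k ih =>
      have h1 := h (((2 : ℝ) ^ (k + 1))⁻¹ • v)
      rw [smul_smul] at h1
      have h2 : (2 : ℝ) * ((2 : ℝ) ^ (k + 1))⁻¹ = ((2 : ℝ) ^ k)⁻¹ := by
        rw [pow_succ]; field_simp
      rw [h2, ih, ← h2] at h1
      linarith
  have hlim := hG.hasFDerivAt.lim v (α := ℕ) (c := fun k => (2 : ℝ) ^ k) (l := Filter.atTop) (by
    simpa using tendsto_pow_atTop_atTop_of_one_lt (r := (2 : ℝ)) (by norm_num))
  have hc : (fun k : ℕ => (2 : ℝ) ^ k • (G (0 + ((2 : ℝ) ^ k)⁻¹ • v) - G 0)) = fun _ => G v := by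
    funext k
    rw [zero_add, h0, sub_zero, hp, smul_eq_mul]
    field_simp
  rw [hc] at hlim
  exact tendsto_nhds_unique tendsto_const_nhds hlim

section Cocycle

variable {E : Type*} [AddCommGroup E] {Φ : E → E → ℝ}
  (hc : ∀ a b c, Φ b c - Φ (a + b) c + Φ a (b + c) - Φ a b = 0)

include hc

/-- Alternating sum of the cocycle identity over the three positions of `c` relative to the ordered
pair `a, b`; the terms `Φ a b` and `Φ` of sums cancel by commutativity. -/
theorem cocycle_antisymm_add_left (a b c : E) :
    Φ (a + b) c - Φ c (a + b) = (Φ a c - Φ c a) + (Φ b c - Φ c b) := by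
  have h1 := hc a b c
  have h2 := hc a c b
  have h3 := hc c a b
  rw [add_comm c b] at h2
  rw [add_comm c a] at h3
  linarith

/-- Three instances of the cocycle identity express `Φ (2a) (2b)` as `2 Φ a b` plus the diagonal
terms at `a + b`, `a` and `b`, and these cancel when the diagonal is additive. -/
theorem symm_cocycle_double (hs : ∀ a b, Φ a b = Φ b a) {Λ : E → ℝ}
    (hΛ : ∀ a b, Λ (a + b) = Λ a + Λ b) (hd : ∀ a, Φ a a = Λ a) (a b : E) :
    Φ (a + a) (b + b) = 2 * Φ a b := by
  have h1 := hc a a (b + b)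
  have h2 := hc a b b
  have h3 := hc a b (a + b)
  have h4 := hs b (a + b)
  have h5 : b + (a + b) = a + (b + b) := by abel
  rw [h5] at h3
  have h6 := hd (a + b)
  rw [hΛ, ← hd a, ← hd b] at h6
  linarith

end Cocycle

/-- The symmetrization vanishes because doubling makes it linear on pairs while the cocycle identity
makes it zero on both axes. The antisymmetrization is additive in each slot, and differentiability
upgrades additivity to linearity. -/
theorem cocycle_eq_bilinear {m : ℕ} {Φ : (Fin m → ℝ) → (Fin m → ℝ) → ℝ}
    (hdiff : Differentiable ℝ fun p : (Fin m → ℝ) × (Fin m → ℝ) => Φ p.1 p.2)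
    (hc : ∀ a b c, Φ b c - Φ (a + b) c + Φ a (b + c) - Φ a b = 0) {Λ : (Fin m → ℝ) → ℝ}
    (hΛ : ∀ a b, Λ (a + b) = Λ a + Λ b) (hd : ∀ a, Φ a a = Λ a) (ξ η : Fin m → ℝ) :
    Φ ξ η = 2⁻¹ * ∑ i, ∑ j,
      (Φ (Pi.single i 1) (Pi.single j 1) - Φ (Pi.single j 1) (Pi.single i 1)) * (ξ i * η j) := by
  have hdiff' : Differentiable ℝ fun p : (Fin m → ℝ) × (Fin m → ℝ) => Φ p.2 p.1 :=
    hdiff.comp (differentiable_snd.prodMk differentiable_fst)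
  have hsym : Φ ξ η + Φ η ξ = 0 := by
    let F : (Fin m → ℝ) × (Fin m → ℝ) → ℝ := fun p => Φ p.1 p.2 + Φ p.2 p.1
    have hF : Differentiable ℝ F := hdiff.add hdiff'
    have h2 := fun a b => symm_cocycle_double (Φ := fun a b => Φ a b + Φ b a) (fun a b c => by
      have h1 := hc a b c
      have h2 := hc c b a
      rw [add_comm b a, add_comm c b] at h2
      linarith) (fun a b => add_comm _ _) (Λ := fun a => Λ a + Λ a)
      (fun a b => by rw [hΛ]; ring) (fun a => by rw [hd]) a b
    have h3 := linear_of_map_two_smul hF.differentiableAt (fun v => by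
      have := h2 v.1 v.2
      rw [← two_smul ℝ, ← two_smul ℝ] at this
      exact this)
    -- A cocycle takes the value `Φ 0 0` on both axes, so `F` on the axes equals `F (0, 0)`, which
    -- is zero by linearity.
    have hL : ∀ a, F (a, 0) = 0 := fun a => by
      have e1 := hc a 0 0
      have e2 := hc 0 0 a
      have e3 : F (0, 0) = 0 := by rw [h3]; exact map_zero _
      simp only [add_zero, zero_add] at e1 e2
      simp only [F] at e3 ⊢
      linarith
    have hR : ∀ a, F (0, a) = 0 := fun a => by
      have := hL a
      simp only [F] at this ⊢
      linarith
    change F (ξ, η) = 0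
    have hs : ((ξ, η) : (Fin m → ℝ) × (Fin m → ℝ)) = (ξ, 0) + (0, η) := by simp
    rw [h3, hs, map_add, ← h3, ← h3, hL, hR, add_zero]
  have hadd := cocycle_antisymm_add_left hc
  have hlin : ∀ ξ η : Fin m → ℝ, Φ ξ η - Φ η ξ
      = ∑ i, ξ i * (Φ (Pi.single i 1) η - Φ η (Pi.single i 1)) := fun ξ η => by
    have hη : Differentiable ℝ fun ξ => Φ ξ η - Φ η ξ :=
      (hdiff.comp (differentiable_id.prodMk (differentiable_const η))).sub
        (hdiff'.comp (differentiable_id.prodMk (differentiable_const η)))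
    have h3 := linear_of_map_two_smul hη.differentiableAt fun v => by
      rw [two_smul, hadd]; ring
    have hs : ξ = ∑ i, ξ i • (Pi.single i 1 : Fin m → ℝ) := by
      funext j
      simp [Finset.sum_apply, Pi.single_apply]
    rw [h3]
    conv_lhs => rw [hs]
    rw [map_sum]
    refine Finset.sum_congr rfl fun i _ => ?_
    rw [map_smul, ← h3, smul_eq_mul]
  have hanti : Φ ξ η = 2⁻¹ * (Φ ξ η - Φ η ξ) := by linarith
  rw [hanti, hlin]
  congr 1
  refine Finset.sum_congr rfl fun i _ => ?_
  have := hlin η (Pi.single i 1)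
  rw [← neg_sub, this, ← Finset.sum_neg_distrib, Finset.mul_sum]
  refine Finset.sum_congr rfl fun j _ => ?_
  ring

/-! ### Making the diagonal of a cocycle additive by a coboundary. -/

theorem exists_eq_single_of_degree_eq_one {σ : Type*} {k : σ →₀ ℕ} (hk : k.degree = 1) :
    ∃ i, k = Finsupp.single i 1 := by
  have h0 : k ≠ 0 := by
    rintro rfl
    simp at hk
  obtain ⟨i, hi⟩ := Finsupp.ne_iff.1 h0
  have h := Finsupp.sub_add_single_one_cancel hi
  have hd := congrArg Finsupp.degree h
  rw [map_add, Finsupp.degree_single, hk, Nat.add_eq_right, Finsupp.degree_eq_zero_iff] at hd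
  rw [hd, zero_add] at h
  exact ⟨i, h.symm⟩

/-- The operator `S(ξ) ↦ 2 S(ξ) - S(2ξ)` multiplies degree `d` by `2 - 2^d`, so it is invertible off
degree one, and the degree-one part is what `Λ` absorbs. The divisors are constants, so the
coefficients of `S` stay smooth in `x`; a single `S` serves all points. -/
theorem exists_symbol_dilation {m : ℕ} (P : MvPolynomial (Fin m) (Smooth m)) :
    ∃ S : MvPolynomial (Fin m) (Smooth m), ∀ x, ∃ Λ : (Fin m → ℝ) → ℝ,
      (∀ a b, Λ (a + b) = Λ a + Λ b) ∧
      ∀ ξ, 2 * symbolAt x ξ S - symbolAt x (ξ + ξ) S + Λ ξ = symbolAt x ξ P := by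
  induction P using MvPolynomial.induction_on' with
  | monomial k c =>
    by_cases hk : k.degree = 1
    · obtain ⟨i, rfl⟩ := exists_eq_single_of_degree_eq_one hk
      refine ⟨0, fun x => ⟨fun ξ => c x * ξ i, fun a b => by simp [mul_add], fun ξ => ?_⟩⟩
      simp [symbolAt_monomial]
    · have hr : (2 : ℝ) - 2 ^ k.degree ≠ 0 := by
        intro h
        refine hk (Nat.pow_right_injective le_rfl ?_)
        have : (2 : ℝ) ^ k.degree = 2 ^ 1 := by linarith
        exact_mod_cast this
      refine ⟨MvPolynomial.monomial k (((2 : ℝ) - 2 ^ k.degree)⁻¹ • c), fun x =>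
        ⟨0, by simp, fun ξ => ?_⟩⟩
      have hp : (k.prod fun i e => (ξ + ξ) i ^ e)
          = 2 ^ k.degree * k.prod fun i e => ξ i ^ e := by
        rw [Finsupp.degree_apply, Finsupp.prod, Finsupp.prod, ← Finset.prod_pow_eq_pow_sum,
          ← Finset.prod_mul_distrib]
        refine Finset.prod_congr rfl fun i _ => ?_
        rw [Pi.add_apply, ← two_mul, mul_pow]
      rw [symbolAt_monomial, symbolAt_monomial, symbolAt_monomial, hp, Smooth.smul_apply,
        Pi.zero_apply]
      field_simp
      ring
  | add P Q hP hQ =>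
    obtain ⟨S, hS⟩ := hP
    obtain ⟨S', hS'⟩ := hQ
    refine ⟨S + S', fun x => ?_⟩
    obtain ⟨Λ, h1, h2⟩ := hS x
    obtain ⟨Λ', h1', h2'⟩ := hS' x
    refine ⟨Λ + Λ', fun a b => by simp only [Pi.add_apply, h1, h1']; ring, fun ξ => ?_⟩
    rw [map_add, map_add, map_add, ← h2, ← h2', Pi.add_apply]
    ring

/-- A closed bidifferential operator is the sum of an antisymmetric biderivation and the
coboundary of a differential operator. -/
theorem exists_hkr_add_coboundary {n : ConDim} {B : n.C2} (hB : B ∈ n.diff2)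
    (hB0 : n.δ₂ B = 0) : ∃ π ∈ n.biv, ∃ S, B = n.hkr π + n.δ₁ (opSymbol n.T S) := by
  obtain ⟨Q, rfl⟩ := exists_opSymbol₂ hB
  -- Identifying the two sets of variables restricts the symbol to the diagonal `η = ξ`.
  obtain ⟨S, hS⟩ := exists_symbol_dilation (MvPolynomial.rename (Sum.elim id id) Q)
  -- The symbol at the pair of basis covectors `(e_i, e_j)`, written by dividing out exponentials so
  -- that smoothness in `x` is automatic.
  let a : Fin n.T → Fin n.T → n.A := fun i j =>
    opSymbol₂ n Q (expo (Pi.single i 1)) (expo (Pi.single j 1))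
      * expo (-(Pi.single i 1 + Pi.single j 1))
  have ha : ∀ i j x, a i j x = symbolAt x (Sum.elim (Pi.single i 1) (Pi.single j 1)) Q := by
    intro i j x
    have h1 : (expo (Pi.single i 1 + Pi.single j 1) * expo (-(Pi.single i 1 + Pi.single j 1)) :
        n.A) x = 1 := by
      rw [← expo_add, add_neg_cancel, expo_apply]
      simp
    rw [expo_add] at h1
    simp only [a, Smooth.mul_apply, opSymbol₂_expo] at h1 ⊢
    rw [mul_assoc, h1, mul_one]
  refine ⟨fun i j => a i j - a j i, fun i j => (neg_sub _ _).symm, S, ?_⟩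
  refine diff2_ext hB (add_mem (n.hkr_diff _) (n.δ₁_diff (n.opSymbol_diff S))) fun ξ η x => ?_
  obtain ⟨Λ, hΛ, hd⟩ := hS x
  let Φ : (Fin n.T → ℝ) → (Fin n.T → ℝ) → ℝ := fun ξ η => symbolAt x (Sum.elim ξ η) Q
  -- The symbol of `B - δ(Op S)` at `x`; the choice of `S` makes its diagonal the additive function
  -- `Λ`.
  let Ψ : (Fin n.T → ℝ) → (Fin n.T → ℝ) → ℝ := fun ξ η =>
    Φ ξ η - (symbolAt x η S - symbolAt x (ξ + η) S + symbolAt x ξ S)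
  have hΦ : ∀ a b c, Φ b c - Φ (a + b) c + Φ a (b + c) - Φ a b = 0 := fun a b c => by
    have h : n.δ₂ (opSymbol₂ n Q) (expo a) (expo b) (expo c) x = 0 := by rw [hB0]; rfl
    have h' : n.δ₂ (opSymbol₂ n Q) (expo a) (expo b) (expo c) x
        = expo a x * opSymbol₂ n Q (expo b) (expo c) x
          - opSymbol₂ n Q (expo (a + b)) (expo c) x + opSymbol₂ n Q (expo a) (expo (b + c)) x
          - opSymbol₂ n Q (expo a) (expo b) x * expo c x := by
      rw [expo_add, expo_add]; rfl
    rw [h'] at h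
    simp only [opSymbol₂_expo] at h
    simp only [expo_add, Smooth.mul_apply] at h
    have hne : expo a x * expo b x * expo c x ≠ 0 :=
      mul_ne_zero (mul_ne_zero (expo_ne_zero _ _) (expo_ne_zero _ _)) (expo_ne_zero _ _)
    refine (mul_eq_zero.1 ?_).resolve_right hne
    rw [← h]
    ring
  have hdiffS : Differentiable ℝ fun ξ => symbolAt x ξ S := differentiable_symbolAt x S
  have hΨ := cocycle_eq_bilinear (Φ := Ψ) (Λ := Λ) (by
      have h1 : Differentiable ℝ fun p : (Fin n.T → ℝ) × (Fin n.T → ℝ) => Φ p.1 p.2 := by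
        refine (differentiable_symbolAt x Q).comp
          (f := fun p : (Fin n.T → ℝ) × (Fin n.T → ℝ) => Sum.elim p.1 p.2)
          (differentiable_pi.2 fun i => ?_)
        cases i <;> simp only [Sum.elim_inl, Sum.elim_inr] <;> fun_prop
      exact h1.sub (((hdiffS.comp differentiable_snd).sub
        (hdiffS.comp (differentiable_fst.add differentiable_snd))).add
        (hdiffS.comp differentiable_fst)))
    (fun a b c => by
      have := hΦ a b c
      simp only [Ψ]
      rw [add_assoc a b c]
      linarith) hΛ (fun a => by
      have := hd a
      have e : symbolAt x a (MvPolynomial.rename (Sum.elim id id) Q) = Φ a a := by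
        simp only [Φ, symbolAt, MvPolynomial.coe_eval₂Hom, MvPolynomial.eval₂_rename]
        congr 1
        funext i
        cases i <;> rfl
      simp only [Ψ]
      linarith) ξ η
  have hsum : n.hkr (fun i j => a i j - a j i) (expo ξ) (expo η) x
      = 2⁻¹ * (∑ i, ∑ j, (a i j x - a j i x) * (ξ i * η j)) * (expo ξ x * expo η x) := by
    change Smooth.evalHom x (((2⁻¹ : ℝ) • ∑ i, ∑ j, (a i j - a j i) • n.cup (pd i) (pd j))
      (expo ξ) (expo η)) = _
    simp only [LinearMap.smul_apply, LinearMap.sum_apply, ConDim.cup_apply, pd_expo]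
    change 2⁻¹ * Smooth.evalHom x _ = _
    rw [mul_assoc, Finset.sum_mul]
    simp only [map_sum, Finset.sum_mul]
    congr 1
    refine Finset.sum_congr rfl fun i _ => Finset.sum_congr rfl fun j _ => ?_
    change (a i j x + -a j i x) * ((ξ i * expo ξ x) * (η j * expo η x)) = _
    ring
  have hco : n.δ₁ (opSymbol n.T S) (expo ξ) (expo η) x
      = (symbolAt x η S - symbolAt x (ξ + η) S + symbolAt x ξ S) * (expo ξ x * expo η x) := by
    have h' : n.δ₁ (opSymbol n.T S) (expo ξ) (expo η) x
        = expo ξ x * opSymbol n.T S (expo η) x - opSymbol n.T S (expo (ξ + η)) x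
          + opSymbol n.T S (expo ξ) x * expo η x := by
      rw [expo_add]; rfl
    rw [h', opSymbol_expo, opSymbol_expo, opSymbol_expo, expo_add, Smooth.mul_apply]
    ring
  change _ = n.hkr (fun i j => a i j - a j i) (expo ξ) (expo η) x
    + n.δ₁ (opSymbol n.T S) (expo ξ) (expo η) x
  rw [hsum, hco, opSymbol₂_expo, ← add_mul]
  congr 1
  -- The coboundary correction is symmetric in the two covectors, so `Φ` and `Ψ` have the same
  -- antisymmetrization.
  have : (∑ i, ∑ j, (a i j x - a j i x) * (ξ i * η j)) = ∑ i, ∑ j,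
      (Ψ (Pi.single i 1) (Pi.single j 1) - Ψ (Pi.single j 1) (Pi.single i 1)) * (ξ i * η j) := by
    refine Finset.sum_congr rfl fun i _ => Finset.sum_congr rfl fun j _ => ?_
    congr 1
    simp only [Ψ, Φ, ha]
    rw [add_comm (Pi.single j 1 : Fin n.T → ℝ)]
    ring
  rw [this, ← hΨ]
  simp only [Ψ, Φ]
  ring

/-! ### Coefficients of differential operators -/

theorem Finsupp.induction_add_single_one {σ : Type*} {p : (σ →₀ ℕ) → Prop} (zero : p 0)
    (add : ∀ k i, p k → p (k + Finsupp.single i 1)) (k : σ →₀ ℕ) : p k := by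
  induction hd : k.degree generalizing k with
  | zero =>
    rw [Finsupp.degree_eq_zero_iff] at hd
    rwa [hd]
  | succ d ih =>
    have h0 : k ≠ 0 := by
      rintro rfl
      simp at hd
    obtain ⟨i, hi⟩ := Finsupp.ne_iff.1 h0
    have h := Finsupp.sub_add_single_one_cancel hi
    rw [← h]
    refine add _ _ (ih _ ?_)
    rw [← h, map_add, Finsupp.degree_single] at hd
    exact Nat.succ_injective hd

/-- The coordinate function `x^i`. -/
def coord {m : ℕ} (i : Fin m) : Smooth m := ⟨fun x => x i, show ContDiff ℝ ∞ _ from contDiff_apply ℝ ℝ i⟩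

theorem pd_coord {m : ℕ} (i j : Fin m) : pd i (coord j) = if j = i then 1 else 0 := by
  refine Smooth.ext fun x => ?_
  have h : fderiv ℝ (coord j : (Fin m → ℝ) → ℝ) x = ContinuousLinearMap.proj j :=
    (hasFDerivAt_apply j x).fderiv
  rw [pd_apply, h]
  by_cases hij : j = i
  · subst hij
    simp only [ContinuousLinearMap.proj_apply, Pi.single_eq_same, if_true]
    rfl
  · simp only [ContinuousLinearMap.proj_apply, Pi.single_eq_of_ne hij, if_neg hij]
    rfl

theorem pd_one {m : ℕ} (i : Fin m) : pd i (1 : Smooth m) = 0 := by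
  have := pd_mul i (1 : Smooth m) 1
  rw [mul_one, one_mul, mul_one] at this
  exact left_eq_add.1 this

/-- By the Leibniz rule, `[∂_i, x^j]` is `1` or `0`, so the commutator with `x^j` acts on symbols as
a derivation. Together with evaluation at `1`, repeated commutators extract every coefficient up to
a nonzero factorial factor. -/
theorem opSymbol_pderiv {m : ℕ} (S : MvPolynomial (Fin m) (Smooth m)) (j : Fin m)
    (f : Smooth m) :
    opSymbol m (MvPolynomial.pderiv j S) f
      = opSymbol m S (coord j * f) - coord j * opSymbol m S f := by
  induction S using MvPolynomial.induction_on generalizing f with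
  | C a =>
    rw [MvPolynomial.pderiv_C, map_zero, opSymbol_C, opSymbol_C, LinearMap.zero_apply]
    ring
  | add P Q hP hQ =>
    simp only [map_add, LinearMap.add_apply, hP, hQ]
    ring
  | mul_X P i hP =>
    rw [MvPolynomial.pderiv_mul, map_add, LinearMap.add_apply, ConDim.opSymbol_mul_X,
      ConDim.opSymbol_mul_X, LinearMap.comp_apply, LinearMap.comp_apply, LinearMap.comp_apply, hP,
      pd_mul, map_add, pd_coord]
    by_cases h : j = i
    · subst h
      rw [MvPolynomial.pderiv_X_self, mul_one, if_pos rfl, one_mul]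
      ring
    · rw [MvPolynomial.pderiv_X_of_ne (Ne.symm h), mul_zero, map_zero, if_neg h, zero_mul, map_zero,
        LinearMap.zero_apply]
      ring

theorem opSymbol_one {m : ℕ} (S : MvPolynomial (Fin m) (Smooth m)) :
    opSymbol m S 1 = MvPolynomial.coeff 0 S := by
  induction S using MvPolynomial.induction_on with
  | C a => rw [opSymbol_C, MvPolynomial.coeff_zero_C, mul_one]
  | add P Q hP hQ => rw [map_add, LinearMap.add_apply, hP, hQ, MvPolynomial.coeff_add]
  | mul_X P i hP =>
    rw [ConDim.opSymbol_mul_X, LinearMap.comp_apply, pd_one, map_zero]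
    simp [MvPolynomial.coeff_mul_X']

theorem opSymbol_apply {m : ℕ} (S : MvPolynomial (Fin m) (Smooth m)) (f : Smooth m) :
    opSymbol m S f = ∑ k ∈ S.support, MvPolynomial.coeff k S * pdPow k f := by
  conv_lhs => rw [← MvPolynomial.support_sum_monomial_coeff S]
  rw [map_sum, LinearMap.sum_apply]
  refine Finset.sum_congr rfl fun k _ => ?_
  rw [ConDim.opSymbol_monomial]
  rfl

theorem pdPow_zero_apply {m : ℕ} (f : Smooth m) : pdPow 0 f = f := by
  have := opSymbol_C 1 f
  rwa [MvPolynomial.C_apply, ConDim.opSymbol_monomial, one_smul, one_mul] at this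

/-- Removes the integer factor produced by differentiating a monomial of the symbol. -/
theorem Smooth.mem_of_mul_natCast {m : ℕ} (M : Submodule ℝ (Smooth m)) {a : Smooth m} {e : ℕ}
    (h : a * ((e : Smooth m) + 1) ∈ M) : a ∈ M := by
  have he : ((e : ℝ) + 1) ≠ 0 := by positivity
  have : a * ((e : Smooth m) + 1) = ((e : ℝ) + 1) • a := by
    rw [add_smul, one_smul, mul_add, mul_one, Nat.cast_smul_eq_nsmul, nsmul_eq_mul, mul_comm]
  rw [this] at h
  simpa [smul_smul, inv_mul_cancel₀ he] using M.smul_mem ((e : ℝ) + 1)⁻¹ h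

namespace ConDim

variable (n : ConDim)

/-! ### Coefficient conditions for operators preserving the constraint functions. -/

theorem coord_mem_fnZ {i : Fin n.T} (hi : n.N ≤ i) : coord i ∈ n.fnZ := fun _ hx => hx i hi

theorem coord_mem_fnN {i : Fin n.T} (hi : n.Z ≤ i) : coord i ∈ n.fnN := fun j hj => by
  rw [pd_coord, if_neg (by rintro rfl; exact absurd hj (not_lt.2 hi))]
  exact zero_mem _

/-- Since `fnZ` is an ideal, commutators with arbitrary coordinates still preserve it, which strips
`k` down to the single normal index `i`. The last commutator, evaluated at `1`, lies in `fnZ`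
because `x^i` does. -/
theorem coeff_mem_fnZ {S : MvPolynomial (Fin n.T) n.A}
    (hS : ∀ f ∈ n.fnZ, opSymbol n.T S f ∈ n.fnZ) {k : Fin n.T →₀ ℕ} {i : Fin n.T}
    (hi : n.N ≤ i) (hk : k i ≠ 0) : MvPolynomial.coeff k S ∈ n.fnZ := by
  rw [← Finsupp.sub_add_single_one_cancel hk]
  generalize k - Finsupp.single i 1 = k
  induction k using Finsupp.induction_add_single_one generalizing S with
  | zero =>
    refine Smooth.mem_of_mul_natCast (n.fnZ.restrictScalars ℝ)
      (e := (0 : Fin n.T →₀ ℕ) i) ?_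
    rw [← MvPolynomial.coeff_pderiv, ← opSymbol_one, opSymbol_pderiv, mul_one]
    exact sub_mem (hS _ (n.coord_mem_fnZ hi)) (n.mul_fnZ_left (n.coord_mem_fnZ hi))
  | add k j ih =>
    rw [add_right_comm]
    refine Smooth.mem_of_mul_natCast (n.fnZ.restrictScalars ℝ)
      (e := (k + Finsupp.single i 1 : Fin n.T →₀ ℕ) j) ?_
    rw [← MvPolynomial.coeff_pderiv]
    refine ih fun f hf => ?_
    rw [opSymbol_pderiv]
    exact sub_mem (hS _ (n.mul_fnZ_right hf)) (n.mul_fnZ_right (hS _ hf))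

/-- Here only coordinates transverse to the distribution may be used for commutators: they lie in
the subalgebra `fnN`, while a coordinate along `D` does not. -/
theorem coeff_mem_fnN {S : MvPolynomial (Fin n.T) n.A}
    (hS : ∀ f ∈ n.fnN, opSymbol n.T S f ∈ n.fnN) {k : Fin n.T →₀ ℕ}
    (hk : ∀ i, k i ≠ 0 → n.Z ≤ i) : MvPolynomial.coeff k S ∈ n.fnN := by
  induction k using Finsupp.induction_add_single_one generalizing S with
  | zero =>
    rw [← opSymbol_one]
    exact hS _ (one_mem _)
  | add k j ih =>
    refine Smooth.mem_of_mul_natCast (Subalgebra.toSubmodule n.fnN) (e := k j) ?_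
    rw [← MvPolynomial.coeff_pderiv]
    have hj : coord j ∈ n.fnN := n.coord_mem_fnN (hk j (by simp))
    refine ih (fun f hf => ?_) fun i hi => hk i (by simp [hi])
    rw [opSymbol_pderiv]
    exact sub_mem (hS _ (mul_mem hj hf)) (mul_mem hj (hS _ hf))

theorem pdPow_fnZ {k : Fin n.T →₀ ℕ} (hk : ∀ i, k i ≠ 0 → i < n.N) {f : n.A} (hf : f ∈ n.fnZ) :
    pdPow k f ∈ n.fnZ := by
  induction k using Finsupp.induction_add_single_one generalizing f with
  | zero => rwa [pdPow_zero_apply]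
  | add k j ih =>
    rw [pdPow_add_single]
    exact ih (fun i hi => hk i (by simp [hi])) (n.pd_fnZ hf j (hk j (by simp)))

theorem pdPow_fnN {k : Fin n.T →₀ ℕ} (hk : ∀ i, k i ≠ 0 → i < n.N) {f : n.A} (hf : f ∈ n.fnN) :
    pdPow k f ∈ n.fnN := by
  induction k using Finsupp.induction_add_single_one generalizing f with
  | zero => rwa [pdPow_zero_apply]
  | add k j ih =>
    rw [pdPow_add_single]
    refine ih (fun i hi => hk i (by simp [hi])) fun l hl => ?_
    rw [pd_comm]
    exact n.pd_fnZ (hf l hl) j (hk j (by simp))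

theorem pdPow_fnN_of_dist {k : Fin n.T →₀ ℕ} (hk : ∀ i, k i ≠ 0 → i < n.N) {i : Fin n.T}
    (hi : i < n.Z) (hki : k i ≠ 0) {f : n.A} (hf : f ∈ n.fnN) : pdPow k f ∈ n.fnZ := by
  rw [← Finsupp.sub_add_single_one_cancel hki, pdPow_add_single]
  refine n.pdPow_fnZ (fun j hj => hk j fun h => hj ?_) (hf i hi)
  rw [Finsupp.tsub_apply, h, Nat.zero_sub]

theorem opSymbol_fnZ {S : MvPolynomial (Fin n.T) n.A}
    (h1 : ∀ k, ∀ i : Fin n.T, n.N ≤ i → k i ≠ 0 → MvPolynomial.coeff k S ∈ n.fnZ) {f : n.A} (hf : f ∈ n.fnZ) :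
    opSymbol n.T S f ∈ n.fnZ := by
  rw [opSymbol_apply]
  refine sum_mem fun k _ => ?_
  by_cases hk : ∀ i, k i ≠ 0 → i < n.N
  · exact n.mul_fnZ_right (n.pdPow_fnZ hk hf)
  · push Not at hk
    obtain ⟨i, hki, hi⟩ := hk
    exact n.mul_fnZ_left (h1 k i hi hki)

/-- A sufficient criterion, in terms of coefficients, for a differential operator to be a
constraint cochain. -/
theorem opSymbol_mem_diff1N {S : MvPolynomial (Fin n.T) n.A}
    (h1 : ∀ k, ∀ i : Fin n.T, n.N ≤ i → k i ≠ 0 → MvPolynomial.coeff k S ∈ n.fnZ)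
    (h2 : ∀ k : Fin n.T →₀ ℕ, (∀ i, k i ≠ 0 → n.Z ≤ i) → MvPolynomial.coeff k S ∈ n.fnN) :
    opSymbol n.T S ∈ n.diff1N := by
  refine ⟨n.opSymbol_diff S, fun f hf => ?_, fun f hf => n.opSymbol_fnZ h1 hf⟩
  rw [opSymbol_apply]
  refine sum_mem fun k _ => ?_
  by_cases hk : ∀ i, k i ≠ 0 → i < n.N
  · by_cases hk' : ∀ i, k i ≠ 0 → n.Z ≤ i
    · exact mul_mem (h2 k hk') (n.pdPow_fnN hk hf)
    · push Not at hk'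
      obtain ⟨i, hki, hi⟩ := hk'
      exact n.fnZ_le (n.mul_fnZ_right (n.pdPow_fnN_of_dist hk hi hki hf))
  · push Not at hk
    obtain ⟨i, hki, hi⟩ := hk
    exact n.fnZ_le (n.mul_fnZ_left (h1 k i hi hki))

/-! ### Characterization of constraint bivector fields by components -/

theorem single_mem_vecZ {i : Fin n.T} {f : n.A} (h : n.Z ≤ i → f ∈ n.fnZ) :
    (Pi.single i f : n.Vec) ∈ n.vecZ := fun j hj => by
  by_cases hij : j = i
  · subst hij
    rw [Pi.single_eq_same]
    exact h hj
  · rw [Pi.single_eq_of_ne hij]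
    exact zero_mem _

theorem single_mem_vecN {i : Fin n.T} (hi : i < n.N) {f : n.A} (hf : f ∈ n.fnN) :
    (Pi.single i f : n.Vec) ∈ n.vecN := by
  refine ⟨fun j hj => ?_, fun j hj l _ => ?_⟩
  · rw [Pi.single_eq_of_ne (by rintro rfl; exact absurd hi (not_lt.2 hj))]
    exact zero_mem _
  · change pd j ((Pi.single i f : n.Vec) l) ∈ n.fnZ
    by_cases hl : l = i
    · subst hl
      rw [Pi.single_eq_same]
      exact hf j hj
    · rw [Pi.single_eq_of_ne hl, map_zero]
      exact zero_mem _

theorem biv_eq_sum {π : Fin n.T → Fin n.T → n.A} (hπ : π ∈ n.biv) :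
    π = (2⁻¹ : ℝ) • ∑ i, ∑ j, n.wedge (Pi.single i (π i j)) (Pi.single j 1) := by
  have h : (∑ i, ∑ j, n.wedge (Pi.single i (π i j)) (Pi.single j 1)) = (2 : ℝ) • π := by
    funext a b
    simp only [Finset.sum_apply, wedge, Finset.sum_sub_distrib, Pi.smul_apply, Pi.single_apply,
      mul_ite, mul_one, mul_zero, Finset.sum_ite_eq, Finset.mem_univ, if_true]
    rw [hπ b a, sub_neg_eq_add, two_smul]
  rw [h, smul_smul, inv_mul_cancel₀ two_ne_zero, one_smul]

theorem wedge_swap (X Y : n.Vec) : n.wedge X Y = n.wedge Y (-X) := by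
  funext i j
  simp only [wedge, Pi.neg_apply]
  ring

theorem wedge_single_mem_bivZ {i j : Fin n.T} {f : n.A} (h : n.Z ≤ i → n.Z ≤ j → f ∈ n.fnZ) :
    n.wedge (Pi.single i f) (Pi.single j 1) ∈ n.bivZ := by
  by_cases hj : n.Z ≤ j
  · exact Submodule.subset_span ⟨_, n.single_mem_vecZ fun hi => h hi hj, _, rfl⟩
  · rw [wedge_swap]
    exact Submodule.subset_span ⟨_, n.single_mem_vecZ fun hj' => absurd hj' hj, _, rfl⟩

theorem mem_bivZ {π : Fin n.T → Fin n.T → n.A} (hπ : π ∈ n.biv)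
    (h : ∀ i j : Fin n.T, n.Z ≤ i → n.Z ≤ j → π i j ∈ n.fnZ) : π ∈ n.bivZ := by
  rw [n.biv_eq_sum hπ]
  exact n.bivZ.smul_mem _ (sum_mem fun i _ => sum_mem fun j _ => n.wedge_single_mem_bivZ (h i j))

/-- Split into components `f ∂_i ∧ ∂_j`. If an index lies along `D`, the term is in `bivZ` for any
`f`; if an index is normal and the other is not along `D`, then `f` vanishes on `C`; otherwise `f
∂_i` and `∂_j` both belong to `vecN`. -/
theorem mem_bivN {π : Fin n.T → Fin n.T → n.A} (hπ : π ∈ n.biv)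
    (h : ∀ i j : Fin n.T, n.Z ≤ i → n.Z ≤ j → π i j ∈ n.fnN)
    (h' : ∀ i j : Fin n.T, n.N ≤ i → n.Z ≤ j → π i j ∈ n.fnZ) : π ∈ n.bivN := by
  rw [n.biv_eq_sum hπ]
  refine n.bivN.smul_mem _ (sum_mem fun i _ => sum_mem fun j _ => ?_)
  by_cases hi : n.N ≤ i
  · exact Submodule.mem_sup_right (n.wedge_single_mem_bivZ fun _ hj => h' i j hi hj)
  by_cases hj : n.N ≤ j
  · refine Submodule.mem_sup_right (n.wedge_single_mem_bivZ fun hi' _ => ?_)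
    rw [hπ]
    exact neg_mem (h' j i hj hi')
  by_cases hi' : n.Z ≤ i
  · by_cases hj' : n.Z ≤ j
    · exact Submodule.mem_sup_left (Submodule.subset_span
        ⟨_, n.single_mem_vecN (not_le.1 hi) (h i j hi' hj'), _,
          n.single_mem_vecN (not_le.1 hj) (one_mem _), rfl⟩)
    · exact Submodule.mem_sup_right (n.wedge_single_mem_bivZ fun _ h => absurd h hj')
  · exact Submodule.mem_sup_right (n.wedge_single_mem_bivZ fun h _ => absurd h hi')

/-! ### Recovering the bivector field by antisymmetrization. -/

theorem hkr_apply (π : Fin n.T → Fin n.T → n.A) (f g : n.A) :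
    n.hkr π f g = (2⁻¹ : ℝ) • ∑ i, ∑ j, π i j * (pd i f * pd j g) := by
  change ((2⁻¹ : ℝ) • ∑ i, ∑ j, π i j • n.cup (pd i) (pd j)) f g = _
  simp only [LinearMap.smul_apply, LinearMap.sum_apply, cup_apply, smul_eq_mul]

theorem hkr_coord (π : Fin n.T → Fin n.T → n.A) (i j : Fin n.T) :
    n.hkr π (coord i) (coord j) = (2⁻¹ : ℝ) • π i j := by
  rw [hkr_apply]
  simp [pd_coord]

theorem hkr_swap {π : Fin n.T → Fin n.T → n.A} (hπ : π ∈ n.biv) (f g : n.A) :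
    n.hkr π g f = -n.hkr π f g := by
  rw [hkr_apply, hkr_apply, Finset.sum_comm, ← smul_neg, ← Finset.sum_neg_distrib]
  congr 1
  refine Finset.sum_congr rfl fun i _ => ?_
  rw [← Finset.sum_neg_distrib]
  refine Finset.sum_congr rfl fun j _ => ?_
  rw [hπ j i]
  ring

/-- Commutativity of the algebra makes coboundaries symmetric, hence invisible to
antisymmetrization. -/
theorem δ₁_swap (D : n.C1) (f g : n.A) : n.δ₁ D g f = n.δ₁ D f g := by
  rw [δ₁_apply, δ₁_apply, mul_comm f g]
  ring

/-- The biderivation part of a cochain is its antisymmetrization. -/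
theorem hkr_eq_antisymm {B : n.C2} {π : Fin n.T → Fin n.T → n.A} (hπ : π ∈ n.biv) {D : n.C1}
    (h : B = n.hkr π + n.δ₁ D) (f g : n.A) :
    n.hkr π f g = (2⁻¹ : ℝ) • (B f g - B g f) := by
  have e : ∀ f g, B f g = n.hkr π f g + n.δ₁ D f g := fun f g => by rw [h]; rfl
  rw [e, e, n.hkr_swap hπ f g, n.δ₁_swap D f g]
  have : n.hkr π f g + n.δ₁ D f g - (-n.hkr π f g + n.δ₁ D f g) = (2 : ℝ) • n.hkr π f g := by
    rw [two_smul]; ring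
  rw [this, smul_smul, inv_mul_cancel₀ two_ne_zero, one_smul]

theorem eq_hkr_coord (π : Fin n.T → Fin n.T → n.A) (i j : Fin n.T) :
    π i j = (2 : ℝ) • n.hkr π (coord i) (coord j) := by
  rw [hkr_coord, smul_smul, mul_inv_cancel₀ two_ne_zero, one_smul]

theorem eq_zero_of_hkr_eq_δ₁ {π : Fin n.T → Fin n.T → n.A} (hπ : π ∈ n.biv) {D : n.C1}
    (h : n.hkr π = n.δ₁ D) : π = 0 := by
  funext i j
  have := n.hkr_eq_antisymm (B := 0) hπ (D := -D) (by rw [map_neg, h, add_neg_cancel])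
    (coord i) (coord j)
  rw [n.eq_hkr_coord π, this]
  simp

/-- The components of `π` are antisymmetrized values of `B` on coordinates, and a coordinate lies in
`fnN` off the distribution and in `fnZ` in the normal directions. No constraint on `D` is needed. -/
theorem bivN_of_cochain {B : n.C2} (hB : B ∈ n.diff2N) {π : Fin n.T → Fin n.T → n.A}
    (hπ : π ∈ n.biv) {D : n.C1} (h : B = n.hkr π + n.δ₁ D) : π ∈ n.bivN := by
  refine n.mem_bivN hπ (fun i j hi hj => ?_) fun i j hi hj => ?_ <;>
    rw [n.eq_hkr_coord π, n.hkr_eq_antisymm hπ h]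
  · exact n.fnN.smul_mem (n.fnN.smul_mem (sub_mem
      (hB.2.1 _ (n.coord_mem_fnN hi) _ (n.coord_mem_fnN hj))
      (hB.2.1 _ (n.coord_mem_fnN hj) _ (n.coord_mem_fnN hi))) _) _
  · exact (n.fnZ.restrictScalars ℝ).smul_mem _ ((n.fnZ.restrictScalars ℝ).smul_mem _ (sub_mem
      (hB.2.2.1 _ (n.coord_mem_fnZ hi) _ (n.coord_mem_fnN hj))
      (hB.2.2.2 _ (n.coord_mem_fnN hj) _ (n.coord_mem_fnZ hi))))

theorem bivZ_of_cochain {B : n.C2} (hB : B ∈ n.diff2Z) {π : Fin n.T → Fin n.T → n.A}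
    (hπ : π ∈ n.biv) {D : n.C1} (h : B = n.hkr π + n.δ₁ D) : π ∈ n.bivZ := by
  refine n.mem_bivZ hπ fun i j hi hj => ?_
  rw [n.eq_hkr_coord π, n.hkr_eq_antisymm hπ h]
  exact (n.fnZ.restrictScalars ℝ).smul_mem _ ((n.fnZ.restrictScalars ℝ).smul_mem _ (sub_mem
    (hB.2 _ (n.coord_mem_fnN hi) _ (n.coord_mem_fnN hj))
    (hB.2 _ (n.coord_mem_fnN hj) _ (n.coord_mem_fnN hi))))

end ConDim

/-! ### A criterion for isomorphisms of constraint modules. -/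

namespace ConModule

variable {R : Type} [CommRing R]

/-- A morphism of constraint modules with bijective components which is also surjective on
`0`-components is an isomorphism. -/
theorem Hom.isIso_of_bijective {E F : ConModule R} (f : Hom E F) (hT : Function.Bijective f.T)
    (hN : Function.Bijective f.N) (hZ : ∀ x, f.N x ∈ F.Z → x ∈ E.Z) : f.IsIso := by
  let eT := LinearEquiv.ofBijective f.T hT
  let eN := LinearEquiv.ofBijective f.N hN
  have hTs : ∀ y, f.T (eT.symm y) = y := eT.apply_symm_apply
  have hNs : ∀ y, f.N (eN.symm y) = y := eN.apply_symm_apply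
  refine ⟨⟨eT.symm, eN.symm, fun y => hT.1 ?_, fun y hy => hZ _ ?_⟩, ?_, ?_⟩
  · change f.T (E.ι (eN.symm y)) = f.T (eT.symm (F.ι y))
    rw [hTs, ← f.comm, hNs]
  · change f.N (eN.symm y) ∈ F.Z
    rwa [hNs]
  · simp only [Hom.comp, Hom.id, Hom.mk.injEq]
    exact ⟨LinearMap.ext eT.symm_apply_apply, LinearMap.ext eN.symm_apply_apply⟩
  · simp only [Hom.comp, Hom.id, Hom.mk.injEq]
    exact ⟨LinearMap.ext hTs, LinearMap.ext hNs⟩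

end ConModule

namespace ConDim

variable (n : ConDim)

/-! ### Restriction to the submanifold -/

/-- The inclusion `ℝ^{n_N} → ℝ^{n_T}`. -/
def embed (y : Fin n.N → ℝ) : Fin n.T → ℝ := fun i => if h : i < n.N then y ⟨i, h⟩ else 0

theorem contDiff_embed : ContDiff ℝ ∞ n.embed := contDiff_pi.2 fun i => by
  by_cases h : i < n.N
  · simp only [embed, dif_pos h]
    exact contDiff_apply ℝ ℝ _
  · simp only [embed, dif_neg h]
    exact contDiff_const

theorem embed_mem (y : Fin n.N → ℝ) : n.embed y ∈ n.sub := fun _ hi => dif_neg (not_lt.2 hi)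

/-- The restriction of functions to the submanifold. -/
def restr (f : n.A) : n.B :=
  ⟨fun y => f (n.embed y), show ContDiff ℝ ∞ _ from f.contDiff.comp n.contDiff_embed⟩

theorem restr_zero : n.restr 0 = 0 := rfl

theorem sub_prolFn_restr (f : n.A) : f - n.prolFn (n.restr f) ∈ n.fnZ := fun x hx => by
  have h : n.embed (fun i => x (Fin.castLE n.hNT i)) = x := by
    funext i
    by_cases h : i < n.N
    · simp only [embed, dif_pos h]
      rfl
    · simp only [embed, dif_neg h]
      exact (hx i (not_lt.1 h)).symm
  change f x - f (n.embed fun i => x (Fin.castLE n.hNT i)) = 0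
  rw [h, sub_self]

theorem eq_zero_of_prolFn_mem {b : n.B} (hb : n.prolFn b ∈ n.fnZ) : b = 0 :=
  Smooth.ext fun y => by
    have h : (fun i : Fin n.N => n.embed y (Fin.castLE n.hNT i)) = y := by
      funext i
      exact dif_pos i.2
    have := hb _ (n.embed_mem y)
    change b (fun i : Fin n.N => n.embed y (Fin.castLE n.hNT i)) = 0 at this
    rwa [h] at this

theorem coeff_prol (P : n.SymC) (k : Fin n.T →₀ ℕ) :
    MvPolynomial.coeff k (n.prol P) = n.prolFn (MvPolynomial.coeff k P) :=
  MvPolynomial.coeff_map _ _ _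

/-! ### The extended symbols -/

/-- The property is closed under sums and scaling by functions, so it suffices to see it on products
ending in one distribution symbol and one normal symbol. In particular every exponent has degree at
least two. -/
theorem coeff_extSym {P : n.SymC} (hP : P ∈ n.extSym) {k : Fin n.T →₀ ℕ}
    (hk : MvPolynomial.coeff k P ≠ 0) :
    ∃ i j : Fin n.T, n.N ≤ i ∧ j < n.Z ∧ ∃ l, k = l + Finsupp.single i 1 + Finsupp.single j 1 := by
  let M : Submodule n.B n.SymC :=
    { carrier := {P | ∀ k, MvPolynomial.coeff k P ≠ 0 → ∃ i j : Fin n.T, n.N ≤ i ∧ j < n.Z ∧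
        ∃ l, k = l + Finsupp.single i 1 + Finsupp.single j 1}
      add_mem' := fun {P Q} hP hQ k hk => by
        by_cases h : MvPolynomial.coeff k P = 0
        · refine hQ k fun h' => hk ?_
          rw [MvPolynomial.coeff_add, h, h', add_zero]
        · exact hP k h
      zero_mem' := fun k hk => absurd (MvPolynomial.coeff_zero k) hk
      smul_mem' := fun b P hP k hk => hP k fun h => hk (by
        rw [MvPolynomial.coeff_smul, h, smul_zero]) }
  suffices h : n.extSym ≤ M from h hP k hk
  refine iSup_le fun d => Submodule.mul_le.2 fun P hP Q hQ => ?_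
  induction hQ using Submodule.span_induction with
  | zero => rw [mul_zero]; exact zero_mem _
  | add Q R _ _ hQ hR => rw [mul_add]; exact add_mem hQ hR
  | smul b Q _ hQ => rw [mul_smul_comm]; exact M.smul_mem b hQ
  | mem Q hQ =>
    obtain ⟨i, hi, rfl⟩ := hQ
    rw [pow_succ] at hP
    induction hP using Submodule.mul_induction_on' with
    | add P _ P' _ h h' => rw [add_mul]; exact add_mem h h'
    | mem_mul_mem P _ R hR =>
      induction hR using Submodule.span_induction with
      | zero => rw [mul_zero, zero_mul]; exact zero_mem _
      | add Q R _ _ hQ hR => rw [mul_add, add_mul]; exact add_mem hQ hR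
      | smul b Q _ hQ => rw [mul_smul_comm, smul_mul_assoc]; exact M.smul_mem b hQ
      | mem Q hQ =>
        obtain ⟨j, hj, rfl⟩ := hQ
        intro k hk
        rw [MvPolynomial.coeff_mul_X'] at hk
        split_ifs at hk with hki
        · rw [MvPolynomial.coeff_mul_X'] at hk
          split_ifs at hk with hkj
          · refine ⟨i, j, hi, hj, k - Finsupp.single i 1 - Finsupp.single j 1, ?_⟩
            rw [add_right_comm, Finsupp.sub_add_single_one_cancel (Finsupp.mem_support_iff.1 hkj),
              Finsupp.sub_add_single_one_cancel (Finsupp.mem_support_iff.1 hki)]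
          · exact absurd rfl hk
        · exact absurd rfl hk

theorem monomial_mem_symDist_pow {k : Fin n.T →₀ ℕ} (hk : ∀ i, k i ≠ 0 → i < n.Z) :
    (MvPolynomial.monomial k 1 : n.SymC) ∈ n.symDist ^ k.degree := by
  induction k using Finsupp.induction_add_single_one with
  | zero =>
    rw [map_zero, pow_zero]
    exact Submodule.one_le.1 le_rfl
  | add k i ih =>
    rw [map_add, Finsupp.degree_single, pow_succ, ← mul_one (1 : n.B),
      ← MvPolynomial.monomial_mul]
    exact Submodule.mul_mem_mul (ih fun j hj => hk j (by simp [hj]))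
      (Submodule.subset_span ⟨i, hk i (by simp), rfl⟩)

theorem monomial_mem_extSym {a : Fin n.T →₀ ℕ} (ha0 : a ≠ 0) (ha : ∀ j, a j ≠ 0 → j < n.Z)
    {i : Fin n.T} (hi : n.N ≤ i) (b : n.B) :
    (MvPolynomial.monomial (a + Finsupp.single i 1) b : n.SymC) ∈ n.extSym := by
  have h : (MvPolynomial.monomial (a + Finsupp.single i 1) b : n.SymC)
      = b • (MvPolynomial.monomial a 1 * MvPolynomial.X i) := by
    rw [MvPolynomial.X, MvPolynomial.monomial_mul, MvPolynomial.smul_monomial]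
    simp
  rw [h]
  -- The summand of index `d` carries the power `d + 1` of the distribution symbols, hence the
  -- shift; `a ≠ 0` makes it legitimate.
  refine n.extSym.smul_mem _ (Submodule.mem_iSup_of_mem (a.degree - 1) ?_)
  rw [Nat.sub_add_cancel (Nat.one_le_iff_ne_zero.2 fun h =>
    ha0 ((Finsupp.degree_eq_zero_iff a).1 h))]
  exact Submodule.mul_mem_mul (n.monomial_mem_symDist_pow ha) (Submodule.subset_span ⟨i, hi, rfl⟩)

/-- An element of `extSym` whose operator differs from a constraint operator by a derivation
vanishes. -/
theorem eq_zero_of_δ₁_opProl {P : n.SymC} (hP : P ∈ n.extSym) {D : n.C1} (hD : D ∈ n.diff1N)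
    (h : n.δ₁ (n.opProl P) = n.δ₁ D) : P = 0 := by
  ext k : 1
  by_contra hk
  obtain ⟨i, j, hi, -, l, rfl⟩ := n.coeff_extSym hP hk
  refine hk (n.eq_zero_of_prolFn_mem ?_)
  rw [← coeff_prol]
  refine Smooth.mem_of_mul_natCast (n.fnZ.restrictScalars ℝ)
    (e := (l + Finsupp.single i 1 : Fin n.T →₀ ℕ) j) ?_
  rw [← MvPolynomial.coeff_pderiv]
  refine n.coeff_mem_fnZ (fun f hf => ?_) hi (by simp)
  -- Equal coboundaries mean that the commutators of `opProl P` and `D` with `x^j` differ by a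
  -- multiplication operator. The commutator of `D` preserves `fnZ`, so that of `opProl P` does too.
  have h1 : n.δ₁ (n.opProl P) (coord j) f = n.δ₁ D (coord j) f := by rw [h]
  rw [δ₁_apply, δ₁_apply] at h1
  rw [opSymbol_pderiv]
  change n.opProl P (coord j * f) - coord j * n.opProl P f ∈ n.fnZ
  have h2 : n.opProl P (coord j * f) - coord j * n.opProl P f
      = n.opProl P (coord j) * f - coord j * D f + D (coord j * f) - D (coord j) * f := by
    linear_combination -h1
  rw [h2]
  exact sub_mem (add_mem (sub_mem (n.mul_fnZ_right hf) (n.mul_fnZ_right (hD.2.2 f hf)))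
    (hD.2.2 _ (n.mul_fnZ_right hf))) (n.mul_fnZ_right hf)

/-! ### Splitting off the linear part and the extended part of a symbol. -/

theorem δ₁_pd (i : Fin n.T) : n.δ₁ (pd i) = 0 := by
  refine LinearMap.ext fun f => LinearMap.ext fun g => ?_
  rw [δ₁_apply, pd_mul, LinearMap.zero_apply, LinearMap.zero_apply]
  ring

theorem opSymbol_single (i : Fin n.T) (c : n.A) :
    opSymbol n.T (MvPolynomial.monomial (Finsupp.single i 1) c) = c • pd i := by
  rw [opSymbol_monomial, ← zero_add (Finsupp.single i 1), pdPow_add_single]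
  congr 1
  exact LinearMap.ext fun f => pdPow_zero_apply _

/-- The first-order part of a symbol does not contribute to the coboundary. -/
theorem exists_symbol_without_linear_part (S : MvPolynomial (Fin n.T) n.A) :
    ∃ S', n.δ₁ (opSymbol n.T S') = n.δ₁ (opSymbol n.T S) ∧
      ∀ i, MvPolynomial.coeff (Finsupp.single i 1) S' = 0 := by
  refine ⟨S - ∑ i, MvPolynomial.monomial (Finsupp.single i 1)
    (MvPolynomial.coeff (Finsupp.single i 1) S), ?_, fun i => ?_⟩
  · rw [map_sub, map_sub, map_sum, map_sum, Finset.sum_eq_zero, sub_zero]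
    intro i _
    rw [opSymbol_single, δ₁_smul, δ₁_pd, smul_zero]
  · rw [MvPolynomial.coeff_sub, MvPolynomial.coeff_sum, Finset.sum_eq_single i, sub_eq_zero,
      MvPolynomial.coeff_monomial, if_pos rfl]
    · intro j _ hj
      rw [MvPolynomial.coeff_monomial, if_neg]
      exact fun h => hj (Finsupp.single_left_injective one_ne_zero h)
    · simp

/-- Exponents of the form `a + e_i` with `a ≠ 0` in the directions of the distribution and `i` a
normal direction. -/
def IsExtExponent (k : Fin n.T →₀ ℕ) : Prop :=
  ∃ a : Fin n.T →₀ ℕ, a ≠ 0 ∧ (∀ j, a j ≠ 0 → j < n.Z) ∧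
    ∃ i : Fin n.T, n.N ≤ i ∧ k = a + Finsupp.single i 1

open scoped Classical in
/-- The part in `extSym` of the restriction of a symbol. -/
def extPart (S : MvPolynomial (Fin n.T) n.A) : n.SymC :=
  ∑ k ∈ S.support with n.IsExtExponent k,
    MvPolynomial.monomial k (n.restr (MvPolynomial.coeff k S))

theorem extPart_mem (S : MvPolynomial (Fin n.T) n.A) : n.extPart S ∈ n.extSym := by
  classical
  refine sum_mem fun k hk => ?_
  obtain ⟨a, ha0, ha, i, hi, rfl⟩ := (Finset.mem_filter.1 hk).2
  exact n.monomial_mem_extSym ha0 ha hi _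

open scoped Classical in
theorem coeff_extPart (S : MvPolynomial (Fin n.T) n.A) (k : Fin n.T →₀ ℕ) :
    MvPolynomial.coeff k (n.extPart S)
      = if n.IsExtExponent k then n.restr (MvPolynomial.coeff k S) else 0 := by
  simp only [extPart, MvPolynomial.coeff_sum, MvPolynomial.coeff_monomial, Finset.sum_ite_eq',
    Finset.mem_filter, MvPolynomial.mem_support_iff]
  by_cases h : MvPolynomial.coeff k S = 0
  · simp [h, restr_zero]
  · simp [h]

/-- A coboundary of a differential operator which is a constraint cochain is, up to an extended
symbol, the coboundary of a constraint cochain. -/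
theorem exists_opProl_add {S : MvPolynomial (Fin n.T) n.A}
    (hS1 : ∀ i, MvPolynomial.coeff (Finsupp.single i 1) S = 0)
    (hS : n.δ₁ (opSymbol n.T S) ∈ n.diff2N) :
    ∃ P ∈ n.extSym, opSymbol n.T S - n.opProl P ∈ n.diff1N := by
  refine ⟨n.extPart S, n.extPart_mem S, ?_⟩
  set P := n.extPart S with hPdef
  have hP : P ∈ n.extSym := n.extPart_mem S
  have hop : opSymbol n.T S - n.opProl P = opSymbol n.T (S - n.prol P) := (map_sub _ _ _).symm
  -- The value of the coboundary at `(x^j, f)` is minus the commutator with `x^j` applied to `f`, up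
  -- to a multiple of `f`; for `x^j ∈ fnN` the constraint condition applies to it.
  have hW : ∀ j : Fin n.T, n.Z ≤ j → ∀ f ∈ n.fnZ,
      opSymbol n.T (MvPolynomial.pderiv j S) f ∈ n.fnZ := fun j hj f hf => by
    have h1 := hS.2.2.2 _ (n.coord_mem_fnN hj) f hf
    rw [δ₁_apply] at h1
    have h2 := sub_mem (n.mul_fnZ_right (f := opSymbol n.T S (coord j)) hf) h1
    rw [opSymbol_pderiv]
    convert h2 using 1
    ring
  have hnormal : ∀ k : Fin n.T →₀ ℕ, ∀ i : Fin n.T, n.N ≤ i → k i ≠ 0 →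
      MvPolynomial.coeff k (S - n.prol P) ∈ n.fnZ := fun k i hi hki => by
    rw [MvPolynomial.coeff_sub, coeff_prol, hPdef, coeff_extPart]
    split_ifs with hk
    · exact n.sub_prolFn_restr _
    rw [map_zero, sub_zero]
    have hk' := Finsupp.sub_add_single_one_cancel hki
    generalize k - Finsupp.single i 1 = a at hk'
    subst hk'
    -- Write `k = a + e_i`. The case `a = 0` is the linear part, absent by `hS1`; when `a` is
    -- nonzero and supported along `D`, the exponent is extended and was treated above. Otherwise
    -- `a` contains some `j` off the distribution, and `hW` applies; a second normal index falls
    -- under this case.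
    by_cases ha0 : a = 0
    · rw [ha0, zero_add, hS1]
      exact zero_mem _
    have ha : ∃ j, a j ≠ 0 ∧ n.Z ≤ j := by
      by_contra! ha
      exact hk ⟨a, ha0, ha, i, hi, rfl⟩
    obtain ⟨j, haj, hj⟩ := ha
    rw [← Finsupp.sub_add_single_one_cancel haj, add_right_comm]
    refine Smooth.mem_of_mul_natCast (n.fnZ.restrictScalars ℝ)
      (e := (a - Finsupp.single j 1 + Finsupp.single i 1 : Fin n.T →₀ ℕ) j) ?_
    rw [← MvPolynomial.coeff_pderiv]
    exact n.coeff_mem_fnZ (hW j hj) hi (by simp)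
  have hδ : n.δ₁ (opSymbol n.T (S - n.prol P)) ∈ n.diff2N := by
    rw [← hop, map_sub]
    exact sub_mem hS (n.δ₁_opProl_Z hP).1
  -- `δD(1, 1) = D(1)` is the zeroth-order coefficient.
  have h0 : MvPolynomial.coeff 0 (S - n.prol P) ∈ n.fnN := by
    have := hδ.2.1 1 (one_mem _) 1 (one_mem _)
    rw [δ₁_apply, mul_one, one_mul, mul_one, sub_self, zero_add] at this
    rwa [← opSymbol_one]
  rw [hop]
  refine n.opSymbol_mem_diff1N hnormal fun k hk => ?_
  by_cases hk0 : k = 0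
  · rwa [hk0]
  obtain ⟨j, hkj⟩ := Finsupp.ne_iff.1 hk0
  have hj := hk j hkj
  have hk' := Finsupp.sub_add_single_one_cancel hkj
  generalize k - Finsupp.single j 1 = a at hk'
  subst hk'
  -- This difference is the coefficient at `e_j`, and it vanishes: `S` has no linear part by `hS1`,
  -- and exponents of `P` have degree at least two.
  have hlin : opSymbol n.T (S - n.prol P) (coord j)
      - coord j * MvPolynomial.coeff 0 (S - n.prol P) ∈ n.fnN := by
    have := opSymbol_pderiv (S - n.prol P) j 1
    rw [opSymbol_one, opSymbol_one, mul_one] at this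
    rw [← this, MvPolynomial.coeff_pderiv, zero_add, MvPolynomial.coeff_sub, hS1, coeff_prol,
      zero_sub]
    by_cases hc : MvPolynomial.coeff (Finsupp.single j 1) P = 0
    · rw [hc, map_zero, neg_zero, zero_mul]
      exact zero_mem _
    · obtain ⟨i, j', -, -, l, hl⟩ := n.coeff_extSym hP hc
      have := congrArg Finsupp.degree hl
      simp only [map_add, Finsupp.degree_single] at this
      omega
  have hcj := n.coord_mem_fnN hj
  refine Smooth.mem_of_mul_natCast (Subalgebra.toSubmodule n.fnN) (e := a j) ?_
  rw [← MvPolynomial.coeff_pderiv]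
  refine n.coeff_mem_fnN (fun f hf => ?_) fun i hi => hk i (by simp [hi])
  have h1 := hδ.2.1 _ hcj f hf
  -- The commutator with `x^j` is rewritten through the coboundary, whose values on `fnN` are
  -- controlled, so `coeff_mem_fnN` applies to the differentiated symbol.
  have h2 : opSymbol n.T (MvPolynomial.pderiv j (S - n.prol P)) f
      = (opSymbol n.T (S - n.prol P) (coord j)
        - coord j * MvPolynomial.coeff 0 (S - n.prol P)) * f
        + coord j * MvPolynomial.coeff 0 (S - n.prol P) * f
        - n.δ₁ (opSymbol n.T (S - n.prol P)) (coord j) f := by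
    rw [opSymbol_pderiv, δ₁_apply]
    ring
  rw [h2]
  exact sub_mem (add_mem (mul_mem hlin hf) (mul_mem (mul_mem hcj h0) hf)) h1

/-- Once the bivector part is known to be constraint, the leftover coboundary is a constraint
cochain as well, and its primitive can be corrected by an extended symbol. -/
theorem exists_constraint_decomposition {B : n.C2} (hB : B ∈ n.diff2N) (hB0 : n.δ₂ B = 0) :
    ∃ π ∈ n.bivN, ∃ P ∈ n.extSym, ∃ D ∈ n.diff1N,
      B = n.hkr π + n.δ₁ (n.opProl P) + n.δ₁ D := by
  obtain ⟨π, hπ, S, hBS⟩ := exists_hkr_add_coboundary hB.1 hB0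
  have hπN := n.bivN_of_cochain hB hπ hBS
  obtain ⟨S', hS', hS'1⟩ := n.exists_symbol_without_linear_part S
  rw [← hS'] at hBS
  have h : n.δ₁ (opSymbol n.T S') ∈ n.diff2N := by
    rw [eq_sub_of_add_eq' hBS.symm]
    exact sub_mem hB (n.hkr_N hπN)
  obtain ⟨P, hP, hD⟩ := n.exists_opProl_add hS'1 h
  refine ⟨π, hπN, P, hP, _, hD, ?_⟩
  rw [map_sub, add_assoc, add_sub_cancel, hBS]

/-! ### Bijectivity of the extended HKR map on each component. -/

theorem bijective_hkrExt_T : Function.Bijective n.hkrExt.T := by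
  constructor
  · refine (injective_iff_map_eq_zero n.hkrExt.T).2 fun π hπ => ?_
    obtain ⟨D, hD⟩ := (Submodule.Quotient.mk_eq_zero _).1 hπ
    have h : n.δ₁ D.1 = n.hkr π.1 := congrArg (fun z => z.1.1) hD
    exact Subtype.ext (n.eq_zero_of_hkr_eq_δ₁ π.2 h.symm)
  · intro c
    obtain ⟨⟨⟨B, hB⟩, hB0⟩, rfl⟩ := Submodule.Quotient.mk_surjective _ c
    obtain ⟨π, hπ, S, hBS⟩ := exists_hkr_add_coboundary hB (congrArg Subtype.val hB0)
    refine ⟨⟨π, hπ⟩, (Submodule.Quotient.eq _).2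
      ⟨⟨-opSymbol n.T S, neg_mem (n.opSymbol_diff S)⟩, Subtype.ext (Subtype.ext ?_)⟩⟩
    change n.δ₁ (-opSymbol n.T S) = n.hkr π - B
    rw [hBS, map_neg]
    abel

theorem bijective_hkrExt_N : Function.Bijective n.hkrExt.N := by
  constructor
  · refine (injective_iff_map_eq_zero n.hkrExt.N).2 fun q hq => ?_
    obtain ⟨D, hD⟩ := (Submodule.Quotient.mk_eq_zero _).1 hq
    have h : n.δ₁ D.1 = n.hkr q.1.1 + n.δ₁ (n.opProl q.2.1) := congrArg (fun z => z.1.1) hD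
    -- A vanishing class makes the antisymmetric `hkr` term equal to a symmetric coboundary, so the
    -- bivector part drops out and only the extended symbol remains.
    have hπ : q.1.1 = 0 := n.eq_zero_of_hkr_eq_δ₁ (n.bivN_le q.1.2)
      (D := D.1 - n.opProl q.2.1) (by rw [map_sub, h, add_sub_cancel_right])
    rw [hπ, map_zero, zero_add] at h
    exact Prod.ext (Subtype.ext hπ) (Subtype.ext (n.eq_zero_of_δ₁_opProl q.2.2 D.2 h.symm))
  · intro c
    obtain ⟨⟨⟨B, hB⟩, hB0⟩, rfl⟩ := Submodule.Quotient.mk_surjective _ c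
    obtain ⟨π, hπ, P, hP, D, hD, h⟩ :=
      n.exists_constraint_decomposition hB (congrArg Subtype.val hB0)
    refine ⟨(⟨π, hπ⟩, ⟨P, hP⟩), (Submodule.Quotient.eq _).2
      ⟨⟨-D, neg_mem hD⟩, Subtype.ext (Subtype.ext ?_)⟩⟩
    change n.δ₁ (-D) = n.hkr π + n.δ₁ (n.opProl P) - B
    rw [h, map_neg]
    abel

/-- Only the bivector part carries a condition, since all extended symbols belong to the
`0`-component. It can be read off from any representative in `diff2Z`, because changing the
representative adds a coboundary. -/
theorem mem_Z_of_hkrExt_N (q : n.bivExt.N) (hq : n.hkrExt.N q ∈ n.HH2.Z) : q ∈ n.bivExt.Z := by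
  obtain ⟨B, hB, hBq⟩ := hq
  obtain ⟨D, hD⟩ := (Submodule.Quotient.eq _).1 hBq
  have h : n.δ₁ D.1 = B.1.1 - (n.hkr q.1.1 + n.δ₁ (n.opProl q.2.1)) :=
    congrArg (fun z => z.1.1) hD
  refine ⟨n.bivZ_of_cochain (B := B.1.1) hB (n.bivN_le q.1.2) (D := n.opProl q.2.1 + D.1) ?_,
    trivial⟩
  change B.1.1 = n.hkr q.1.1 + _
  rw [map_add, h]
  abel

end ConDim
end

/-- The extended constraint HKR map `U_ext : 𝔛²_ext(ℝ^n) → HH²_diff(C^∞(ℝ^n))` is an isomorphism of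
constraint `ℝ`-modules. -/
theorem mainTheorem1 (n : ConDim) : n.hkrExt.IsIso :=
  n.hkrExt.isIso_of_bijective n.bijective_hkrExt_T n.bijective_hkrExt_N n.mem_Z_of_hkrExt_N
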